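/- All graphs are finite, undirected and loopless, and may have multiple edges; logarithms are binary. A graph $H$ is a minor of a graph $G$ if $H$ can be obtained from $G$ by vertex removals, edge removals and edge contractions. For $r\in\mathbb{N}$ let $\theta_r$ be the graph with two vertices and $r$ parallel edges between them, and let $k\cdot\theta_r$ be the disjoint union of $k$ copies of $\theta_r$. Let $\mathrm{tw}(G)$ be the treewidth of $G$, that is, the minimum over all tree-decompositions of $G$ of the maximum size of a bag, minus one. (1) For every graph $G$ and all integers $r\ge 2$ and $k\ge 1$, if $\mathrm{tw}(G)\ \ge\ 2^{6r}\cdot k\cdot\log_2(k+1)$, then $G$ contains $k\cdot\theta_r$ as a minor. (2) Consequently, for every fixed $r$, graphs excluding $k\cdot\theta_r$ as a minor have treewidth $O(k\log k)$: for every $r\in\mathbb{N}$ there is a function $c:\mathbb{N}\to\mathbb{R}$ with $c(k)=O(k\log k)$ as $k\to\infty$ such that, for every $k$, every graph $G$ that does not contain $k\cdot\theta_r$ as a minor satisfies $\mathrm{tw}(G)\le c(k)$. -/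

import Mathlib

namespace Graph

/-- A multigraph is connected if it has a vertex and any two of its vertices are joined by a
sequence of consecutively adjacent vertices. -/
def IsConnected {α β : Type*} (G : Graph α β) : Prop :=
  G.vertexSet.Nonempty ∧
    ∀ x ∈ G.vertexSet, ∀ y ∈ G.vertexSet, Relation.ReflTransGen G.Adj x y

/-- `H.IsMinor G`: the multigraph `H` is a minor of the multigraph `G`, i.e. `H` is obtained (up to
isomorphism) from a subgraph of `G` by contracting pairwise disjoint connected subgraphs
`branch v`, one for each vertex `v` of `H`, to single vertices. The edges of `H` correspond to
distinct edges of `G` that are not contracted and join the branch subgraphs of their ends. -/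
def IsMinor {γ δ α β : Type*} (H : Graph γ δ) (G : Graph α β) : Prop :=
  ∃ (branch : γ → Graph α β) (edge : H.edgeSet → β),
    (∀ v ∈ H.vertexSet, branch v ≤ G ∧ (branch v).IsConnected) ∧
    (∀ v ∈ H.vertexSet, ∀ w ∈ H.vertexSet, v ≠ w →
      Disjoint (branch v).vertexSet (branch w).vertexSet) ∧
    Function.Injective edge ∧
    (∀ e, ∀ v ∈ H.vertexSet, edge e ∉ (branch v).edgeSet) ∧
    (∀ (e : H.edgeSet) (v w : γ), H.IsLink e v w →
      ∃ x ∈ (branch v).vertexSet, ∃ y ∈ (branch w).vertexSet, G.IsLink (edge e) x y)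

/-- The graph `θ_r`: two vertices joined by `r` parallel edges. -/
def theta (r : ℕ) : Graph Bool (Fin r) :=
  Graph.banana false true Set.univ

/-- The graph `k · J`: the disjoint union of `k` copies of `J`. -/
def copies {γ δ : Type*} (k : ℕ) (J : Graph γ δ) : Graph (Fin k × γ) (Fin k × δ) where
  vertexSet := {p | p.2 ∈ J.vertexSet}
  IsLink e x y := x.1 = e.1 ∧ y.1 = e.1 ∧ J.IsLink e.2 x.2 y.2
  isLink_symm := fun _ _ => ⟨fun _ _ h => ⟨h.2.1, h.1, h.2.2.symm⟩⟩
  eq_or_eq_of_isLink_of_isLink := by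
    rintro ⟨i, e⟩ ⟨i₁, x⟩ ⟨i₂, y⟩ ⟨i₃, v⟩ ⟨i₄, w⟩ ⟨h₁, h₂, h⟩ ⟨h₃, h₄, h'⟩
    dsimp only at h₁ h₂ h h₃ h₄ h'
    subst h₁ h₂ h₃ h₄
    rcases h.left_eq_or_eq h' with rfl | rfl
    · exact Or.inl rfl
    · exact Or.inr rfl
  left_mem_of_isLink := fun _ _ _ h => h.2.2.left_mem

/-- A tree-decomposition of `G` whose tree has the (finite) node set `ι`. -/
structure TreeDecomposition {α β : Type*} (G : Graph α β) (ι : Type) where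
  /-- The tree. -/
  tree : SimpleGraph ι
  /-- The bag of each node of the tree. -/
  bag : ι → Set α
  isTree : tree.IsTree
  exists_bag_of_isLink : ∀ e x y, G.IsLink e x y → ∃ t, x ∈ bag t ∧ y ∈ bag t
  connected : ∀ u ∈ G.vertexSet, (tree.induce {t | u ∈ bag t}).Connected
  iUnion_bag : ⋃ t, bag t = G.vertexSet

/-- The width of a tree-decomposition: the maximum size of a bag, minus one. -/
noncomputable def TreeDecomposition.width {α β : Type*} {G : Graph α β} {ι : Type} [Fintype ι]
    (D : TreeDecomposition G ι) : ℤ :=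
  ((Finset.univ.sup fun t => (D.bag t).ncard : ℕ) : ℤ) - 1

/-- The treewidth of a finite multigraph: the minimum width of a tree-decomposition of it
(so the graph without vertices has treewidth `-1`). -/
noncomputable def treewidth {α β : Type*} (G : Graph α β) : ℤ :=
  sInf {w : ℤ | ∃ (ι : Type) (_ : Fintype ι) (D : TreeDecomposition G ι), D.width = w}

end Graph

/-!
Large treewidth gives a vertex weighting such that every removal of few vertices and edges leaves a
part carrying more than half of the weight. Passing to minors, this robustness survives, at a small
cost, the removal of a model of `θ_r` with few vertices (few means `O(log k)` for fixed `r`), and,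
at no cost, the contraction of an edge if its ends together send out few edges or if one of its ends
has no further neighbour. Hence either `k` removals succeed, which yields `k` disjoint models, or
one reaches a nontrivial graph in which no model is small and no such contraction is possible.
There, vertices of low degree are pairwise nonadjacent, and contracting stars around vertices of
high degree makes all degrees large. As no model is small, a ball of small radius spans few edges
and sends fewer than `r` of them to any vertex outside, so balls grow exponentially, and the Voronoi
cells of far-apart centres, whose radius is `O(log k)`, have at least `2k(r + 2)` vertices. For the
same reason a cell has at least as many neighbouring cells as vertices. Contracting the cells thus
gives a graph of average degree at least `2k(r + 2)`, and such a graph contains `k` disjoint models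
of `θ_r`: contracting an edge loses more than `r` edges only if its ends have `r` common neighbours,
which yields a model on at most `r + 2` vertices to remove.
-/

/-- A loopless multigraph with vertex set `V`, given by its edge multiplicities. Forgetting the
identity of the edges makes sums over edges, vertex identifications and edge removals computations
with natural numbers. -/
structure Multigraph (V : Type*) where
  /-- The number of edges between two vertices. -/
  mult : V → V → ℕ
  mult_comm : ∀ x y, mult x y = mult y x
  mult_self : ∀ x, mult x x = 0

namespace Multigraph

section Basic

variable {V W : Type*} {G : Multigraph V} {P P' Q Q' : Finset V} {x y z c : V} {r r' K K' : ℕ}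

/-- The simple graph underlying a multigraph, through which connectivity is expressed. -/
def simple (G : Multigraph V) : SimpleGraph V where
  Adj x y := 0 < G.mult x y
  symm := ⟨fun x y h => G.mult_comm x y ▸ h⟩
  loopless := ⟨fun x h => h.ne' (G.mult_self x)⟩

instance (G : Multigraph V) : DecidableRel G.simple.Adj :=
  fun _ _ => inferInstanceAs (Decidable (0 < _))

/-- `G.Conn P`: the vertex set `P` is nonempty and induces a connected subgraph. -/
def Conn (G : Multigraph V) (P : Finset V) : Prop := (G.simple.induce (P : Set V)).Connected

/-- The number of edges between two disjoint vertex sets; an edge with both ends in `P ∩ Q` is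
counted twice. -/
def edges (G : Multigraph V) (P Q : Finset V) : ℕ := ∑ x ∈ P, ∑ y ∈ Q, G.mult x y

/-- The pair `P`, `Q` is a model of the graph `θ_r` of two vertices joined by `r` edges: contracting
the connected sets `P` and `Q` yields two vertices joined by at least `r` edges. -/
structure IsModel (G : Multigraph V) (r : ℕ) (P Q : Finset V) : Prop where
  conn_left : G.Conn P
  conn_right : G.Conn Q
  disjoint : Disjoint P Q
  le_edges : r ≤ G.edges P Q

/-- `G.NoSmallModel r s`: every model of `θ_r` in `G` has more than `s` vertices. -/
def NoSmallModel (G : Multigraph V) (r s : ℕ) : Prop :=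
  ∀ P Q : Finset V, G.IsModel r P Q → s < P.card + Q.card

section Conn

theorem conn_iff : G.Conn P ↔ P.Nonempty ∧
    ∀ A ⊆ P, A.Nonempty → A ≠ P → ∃ x ∈ A, ∃ y ∈ P, y ∉ A ∧ G.simple.Adj x y := by
  classical
  constructor
  · intro hP
    refine ⟨Finset.coe_nonempty.1 (Set.nonempty_coe_sort.1 hP.nonempty), ?_⟩
    rintro A hAP ⟨a, ha⟩ hne
    obtain ⟨b, hbP, hbA⟩ := Finset.exists_of_ssubset (hAP.ssubset_of_ne hne)
    obtain ⟨w⟩ := hP.preconnected ⟨a, hAP ha⟩ ⟨b, hbP⟩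
    obtain ⟨d, -, h1, h2⟩ := w.exists_boundary_dart {z | z.1 ∈ A} ha hbA
    exact ⟨d.fst, h1, d.snd, d.snd.2, h2, d.adj⟩
  · rintro ⟨⟨c, hc⟩, hcut⟩
    let A := P.filter fun z => ∃ hz : z ∈ P, (G.simple.induce (P : Set V)).Reachable ⟨c, hc⟩ ⟨z, hz⟩
    have hA : A = P := by
      by_contra hne
      obtain ⟨x, hx, y, hy, hyA, hxy⟩ := hcut A (Finset.filter_subset _ _)
        ⟨c, Finset.mem_filter.2 ⟨hc, hc, .refl _⟩⟩ hne
      obtain ⟨hxP, _, hcx⟩ := Finset.mem_filter.1 hx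
      have hxy' : (G.simple.induce (P : Set V)).Adj ⟨x, hxP⟩ ⟨y, hy⟩ := hxy
      exact hyA (Finset.mem_filter.2 ⟨hy, hy, hcx.trans hxy'.reachable⟩)
    refine SimpleGraph.connected_iff_exists_forall_reachable _ |>.2 ⟨⟨c, hc⟩, fun ⟨z, hz⟩ => ?_⟩
    rw [Finset.mem_coe, ← hA] at hz
    exact (Finset.mem_filter.1 hz).2.2

theorem Conn.nonempty (hP : G.Conn P) : P.Nonempty := (conn_iff.1 hP).1

theorem conn_singleton (x : V) : G.Conn {x} :=
  conn_iff.2 ⟨Finset.singleton_nonempty x, fun _ hA hne hA' =>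
    absurd (hne.subset_singleton_iff.1 hA) hA'⟩

theorem Conn.exists_adj_of_mem (hP : G.Conn P) (hx : x ∈ P) (hxy : G.simple.Adj x y) (hz : z ∈ P) :
    ∃ w, G.simple.Adj z w := by
  obtain rfl | hzx := eq_or_ne z x
  · exact ⟨y, hxy⟩
  obtain ⟨a, ha, w, -, -, haw⟩ := (conn_iff.1 hP).2 {z} (Finset.singleton_subset_iff.2 hz)
    (Finset.singleton_nonempty z) fun h => hzx (Finset.mem_singleton.1 (h ▸ hx)).symm
  exact ⟨w, Finset.mem_singleton.1 ha ▸ haw⟩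

variable [DecidableEq V]

theorem Conn.union (hP : G.Conn P) (hQ : G.Conn Q) (hcP : c ∈ P) (hcQ : c ∈ Q) :
    G.Conn (P ∪ Q) := by
  rw [Conn, Finset.coe_union]
  exact SimpleGraph.induce_union_connected hP.preconnected hQ.preconnected ⟨c, hcP, hcQ⟩

theorem Conn.union_of_forall_adj (hP : G.Conn P) (hQ : ∀ y ∈ Q, y ∉ P → ∃ x ∈ P, G.simple.Adj x y) :
    G.Conn (P ∪ Q) := by
  refine conn_iff.2 ⟨hP.nonempty.inl, fun A hA hAne hne => ?_⟩
  obtain ⟨b, hb, hbA⟩ := Finset.exists_of_ssubset (hA.ssubset_of_ne hne)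
  by_cases hPA : P ⊆ A
  · have hbP : b ∉ P := fun h => hbA (hPA h)
    obtain ⟨x, hx, hxb⟩ := hQ b ((Finset.mem_union.1 hb).resolve_left hbP) hbP
    exact ⟨x, hPA hx, b, hb, hbA, hxb⟩
  obtain hAP | ⟨a, ha⟩ := (A ∩ P).eq_empty_or_nonempty
  · obtain ⟨a, ha⟩ := hAne
    have haP : a ∉ P := fun h => Finset.notMem_empty a (hAP ▸ Finset.mem_inter.2 ⟨ha, h⟩)
    obtain ⟨x, hx, hxa⟩ := hQ a ((Finset.mem_union.1 (hA ha)).resolve_left haP) haP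
    exact ⟨a, ha, x, Finset.mem_union_left _ hx,
      fun h => Finset.notMem_empty x (hAP ▸ Finset.mem_inter.2 ⟨h, hx⟩), hxa.symm⟩
  · obtain ⟨x, hx, y, hy, hyA, hxy⟩ := (conn_iff.1 hP).2 (A ∩ P) Finset.inter_subset_right
      ⟨a, ha⟩ fun h => hPA (Finset.inter_eq_right.1 h)
    exact ⟨x, (Finset.mem_inter.1 hx).1, y, Finset.mem_union_left _ hy,
      fun h => hyA (Finset.mem_inter.2 ⟨h, hy⟩), hxy⟩

theorem Conn.insert (hP : G.Conn P) (hx : x ∈ P) (hxy : G.simple.Adj x y) :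
    G.Conn (Insert.insert y P) := by
  rw [Finset.insert_eq, Finset.union_comm]
  refine hP.union_of_forall_adj fun z hz _ => ⟨x, hx, ?_⟩
  rwa [Finset.mem_singleton.1 hz]

theorem conn_pair (hxy : G.simple.Adj x y) : G.Conn {x, y} :=
  (conn_singleton y).insert (Finset.mem_singleton_self y) hxy.symm

theorem Conn.induction_on {motive : Finset V → Prop} (hP : G.Conn P) (hc : c ∈ P)
    (singleton : motive {c})
    (insert : ∀ A, ∀ x ∈ A, ∀ y ∈ P, G.simple.Adj x y → motive A → motive (Insert.insert y A)) :
    motive P := by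
  suffices H : ∀ n < P.card, ∃ A ⊆ P, A.card = n + 1 ∧ motive A by
    have hpos := hP.nonempty.card_pos
    obtain ⟨A, hA, hcard, hmA⟩ := H (P.card - 1) (by lia)
    rwa [Finset.eq_of_subset_of_card_le hA (by lia)] at hmA
  intro n hn
  induction n with
  | zero => exact ⟨{c}, by simpa using hc, by simp, singleton⟩
  | succ n ih =>
    obtain ⟨A, hA, hcard, hmA⟩ := ih (by lia)
    obtain ⟨x, hx, y, hy, hyA, hxy⟩ := (conn_iff.1 hP).2 A hA (Finset.card_pos.1 (by lia))
      (by rintro rfl; lia)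
    exact ⟨Insert.insert y A, Finset.insert_subset hy hA,
      by rw [Finset.card_insert_of_notMem hyA, hcard], insert A x hx y hy hxy hmA⟩

end Conn

section Edges

theorem edges_comm (P Q : Finset V) : G.edges P Q = G.edges Q P := by
  simp_rw [edges, Finset.sum_comm (s := P), G.mult_comm]

theorem edges_mono (hP : P ⊆ P') (hQ : Q ⊆ Q') : G.edges P Q ≤ G.edges P' Q' :=
  (Finset.sum_le_sum fun _ _ => Finset.sum_le_sum_of_subset hQ).trans
    (Finset.sum_le_sum_of_subset hP)

theorem edges_pos_iff : 0 < G.edges P Q ↔ ∃ x ∈ P, ∃ y ∈ Q, G.simple.Adj x y := by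
  simp only [edges, Finset.sum_pos_iff, simple]

theorem edges_singleton (x y : V) : G.edges {x} {y} = G.mult x y := by simp [edges]

end Edges

section IsModel

theorem IsModel.mono (h : G.IsModel r P Q) (hr : r' ≤ r) : G.IsModel r' P Q :=
  { h with le_edges := hr.trans h.le_edges }

theorem IsModel.exists_adj [DecidableEq V] (hr : 0 < r) (h : G.IsModel r P Q) (hz : z ∈ P ∪ Q) :
    ∃ w, G.simple.Adj z w := by
  obtain ⟨x, hx, y, hy, hxy⟩ := edges_pos_iff.1 (hr.trans_le h.le_edges)
  obtain hz | hz := Finset.mem_union.1 hz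
  · exact h.conn_left.exists_adj_of_mem hx hxy hz
  · exact h.conn_right.exists_adj_of_mem hy hxy.symm hz

end IsModel

section Support

variable [Fintype V]

/-- The set of vertices that are not isolated. Edge removals and vertex identifications keep the
vertex type, so that the support plays the role of the vertex set of the resulting graph. -/
def support (G : Multigraph V) : Finset V := {x | ∃ y, G.simple.Adj x y}

/-- The number of edges at a vertex. -/
def deg (G : Multigraph V) (x : V) : ℕ := ∑ y, G.mult x y

theorem mem_support : x ∈ G.support ↔ ∃ y, G.simple.Adj x y := by simp [support]

theorem left_mem_support (h : G.simple.Adj x y) : x ∈ G.support := mem_support.2 ⟨y, h⟩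

theorem right_mem_support (h : G.simple.Adj x y) : y ∈ G.support := left_mem_support h.symm

theorem deg_pos_iff : 0 < G.deg x ↔ x ∈ G.support := by
  simp [mem_support, deg, Finset.sum_pos_iff, simple]

theorem IsModel.union_subset_support [DecidableEq V] (hr : 0 < r) (h : G.IsModel r P Q) :
    P ∪ Q ⊆ G.support := fun _ hz => mem_support.2 (h.exists_adj hr hz)

end Support

section Packing

variable [DecidableEq V]

/-- `G.Packing K r`: there are `K` disjoint models of `θ_r` in `G`. -/
def Packing (G : Multigraph V) (K r : ℕ) : Prop :=
  ∃ P Q : Fin K → Finset V, (∀ i, G.IsModel r (P i) (Q i)) ∧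
    Pairwise fun i j => Disjoint (P i ∪ Q i) (P j ∪ Q j)

theorem Packing.mono (h : G.Packing K r) (hK : K' ≤ K) (hr : r' ≤ r) : G.Packing K' r' := by
  obtain ⟨P, Q, hPQ, hdisj⟩ := h
  exact ⟨fun i => P (i.castLE hK), fun i => Q (i.castLE hK), fun i => (hPQ _).mono hr,
    fun i j hij => hdisj ((Fin.castLE_injective hK).ne hij)⟩

theorem packing_zero (r : ℕ) : G.Packing 0 r :=
  ⟨fun _ => ∅, fun _ => ∅, fun i => i.elim0, fun i => i.elim0⟩

end Packing

section Del

variable [DecidableEq V] {M : Finset V}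

/-- The multigraph obtained by removing all edges that meet `M`. -/
def del (G : Multigraph V) (M : Finset V) : Multigraph V where
  mult x y := if x ∈ M ∨ y ∈ M then 0 else G.mult x y
  mult_comm x y := by simp only [G.mult_comm x y, or_comm]
  mult_self x := by simp [G.mult_self]

theorem mult_del_le (x y : V) : (G.del M).mult x y ≤ G.mult x y := by
  simp only [del]
  split_ifs <;> simp

theorem mult_del_of_notMem (hx : x ∉ M) (hy : y ∉ M) : (G.del M).mult x y = G.mult x y := by
  simp [del, hx, hy]

theorem adj_del : (G.del M).simple.Adj x y ↔ x ∉ M ∧ y ∉ M ∧ G.simple.Adj x y := by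
  by_cases hx : x ∈ M <;> by_cases hy : y ∈ M <;> simp [simple, del, hx, hy]

theorem support_del_subset [Fintype V] : (G.del M).support ⊆ G.support \ M := fun x hx => by
  obtain ⟨y, hxy⟩ := mem_support.1 hx
  obtain ⟨hxM, -, hxy⟩ := adj_del.1 hxy
  exact Finset.mem_sdiff.2 ⟨left_mem_support hxy, hxM⟩

theorem Conn.of_del (h : (G.del M).Conn P) : G.Conn P :=
  SimpleGraph.Connected.mono (SimpleGraph.comap_monotone _ fun _ _ hxy => (adj_del.1 hxy).2.2) h

theorem IsModel.of_del (h : (G.del M).IsModel r P Q) : G.IsModel r P Q where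
  conn_left := h.conn_left.of_del
  conn_right := h.conn_right.of_del
  disjoint := h.disjoint
  le_edges := h.le_edges.trans
    (Finset.sum_le_sum fun x _ => Finset.sum_le_sum fun y _ => mult_del_le x y)

theorem Packing.succ_of_del (hr : 0 < r) (hPQ : G.IsModel r P Q)
    (h : (G.del (P ∪ Q)).Packing K r) : G.Packing (K + 1) r := by
  obtain ⟨P', Q', hmodel, hdisj⟩ := h
  have hdel : ∀ i, Disjoint (P ∪ Q) (P' i ∪ Q' i) := fun i =>
    Finset.disjoint_right.2 fun z hz =>
      let ⟨_, hzw⟩ := (hmodel i).exists_adj hr hz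
      (adj_del.1 hzw).1
  refine ⟨Fin.cons P P', Fin.cons Q Q', Fin.cases hPQ fun i => (hmodel i).of_del, ?_⟩
  rw [pairwise_fin_succ_iff]
  exact ⟨fun i => (hdel i).symm, hdel, hdisj⟩

end Del

section Quot

variable [Fintype V] [DecidableEq W] {h : V → W} {a b : W} {A B : Finset W}

/-- The multigraph obtained by identifying vertices along `h` and removing loops. -/
def quot (G : Multigraph V) (h : V → W) : Multigraph W where
  mult a b := if a = b then 0 else ∑ x with h x = a, ∑ y with h y = b, G.mult x y
  mult_comm a b := by
    simp_rw [eq_comm (a := a), Finset.sum_comm (s := {x | h x = a}), G.mult_comm]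
  mult_self a := if_pos rfl

theorem mult_quot_of_ne (hab : a ≠ b) :
    (G.quot h).mult a b = ∑ x with h x = a, ∑ y with h y = b, G.mult x y := if_neg hab

theorem adj_quot : (G.quot h).simple.Adj a b ↔
    a ≠ b ∧ ∃ x y, h x = a ∧ h y = b ∧ G.simple.Adj x y := by
  by_cases hab : a = b
  · simp [hab]
  · simp only [simple, mult_quot_of_ne hab, Finset.sum_pos_iff, Finset.mem_filter_univ]
    grind

theorem sum_quot [Fintype W] (F : W → W → ℕ) (hF : ∀ a, F a a = 0) :
    ∑ a, ∑ b, F a b * (G.quot h).mult a b = ∑ x, ∑ y, F (h x) (h y) * G.mult x y := by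
  have hfiber : ∀ a b, F a b * (G.quot h).mult a b =
      ∑ x with h x = a, ∑ y with h y = b, F (h x) (h y) * G.mult x y := fun a b => by
    have hsum : F a b * ∑ x with h x = a, ∑ y with h y = b, G.mult x y =
        ∑ x with h x = a, ∑ y with h y = b, F (h x) (h y) * G.mult x y := by
      simp_rw [Finset.mul_sum]
      refine Finset.sum_congr rfl fun x hx => Finset.sum_congr rfl fun y hy => ?_
      rw [(Finset.mem_filter.1 hx).2, (Finset.mem_filter.1 hy).2]
    obtain rfl | hab := eq_or_ne a b
    · rw [← hsum, hF, zero_mul, zero_mul]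
    · rw [mult_quot_of_ne hab, hsum]
  simp_rw [hfiber, Finset.sum_comm (s := (Finset.univ : Finset W)) (t := Finset.filter _ _),
    Finset.sum_fiberwise]

/-- The set of vertices that the identification along `h` maps into `A`. -/
def pre (h : V → W) (A : Finset W) : Finset V := {x | h x ∈ A}

@[simp]
theorem mem_pre {x : V} : x ∈ pre h A ↔ h x ∈ A := by simp [pre]

theorem disjoint_pre (hAB : Disjoint A B) : Disjoint (pre h A) (pre h B) :=
  Finset.disjoint_left.2 fun _ hA hB =>
    Finset.disjoint_left.1 hAB (mem_pre.1 hA) (mem_pre.1 hB)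

theorem sum_pre {M : Type*} [AddCommMonoid M] (A : Finset W) (f : V → M) :
    ∑ x ∈ pre h A, f x = ∑ a ∈ A, ∑ x with h x = a, f x := by
  rw [← Finset.sum_fiberwise_of_maps_to (s := pre h A) (g := h) fun x hx => mem_pre.1 hx]
  refine Finset.sum_congr rfl fun a ha => Finset.sum_congr ?_ fun _ _ => rfl
  ext x
  grind [mem_pre]

theorem edges_quot (hAB : Disjoint A B) :
    (G.quot h).edges A B = G.edges (pre h A) (pre h B) := by
  simp_rw [edges, sum_pre, Finset.sum_comm (s := Finset.filter _ _) (t := B)]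
  exact Finset.sum_congr rfl fun a ha => Finset.sum_congr rfl fun b hb =>
    mult_quot_of_ne (Finset.disjoint_iff_ne.1 hAB a ha b hb)

theorem Conn.pre (hA : (G.quot h).Conn A) (hfiber : ∀ a ∈ A, G.Conn (pre h {a})) :
    G.Conn (pre h A) := by
  classical
  have hsurj : ∀ a ∈ A, ∃ x, h x = a := fun a ha =>
    (hfiber a ha).nonempty.imp fun x hx => by simpa using hx
  refine conn_iff.2 ⟨?_, fun B hBA hBne hne => ?_⟩
  · obtain ⟨a, ha⟩ := hA.nonempty
    exact (hsurj a ha).imp fun x hx => mem_pre.2 (by rwa [hx])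
  by_cases hsplit : ∃ x ∈ B, ∃ y, h y = h x ∧ y ∉ B
  · obtain ⟨x, hx, y, hyx, hy⟩ := hsplit
    obtain ⟨z, hz, w, hw, hwz, hzw⟩ := (conn_iff.1 (hfiber _ (mem_pre.1 (hBA hx)))).2
      (Multigraph.pre h {h x} ∩ B) Finset.inter_subset_left ⟨x, by simp [hx]⟩
      fun heq => hy (Finset.mem_inter.1 (heq.symm ▸ mem_pre.2 (Finset.mem_singleton.2 hyx))).2
    rw [Finset.mem_inter, mem_pre, Finset.mem_singleton] at hz
    refine ⟨z, hz.2, w, ?_, fun h => hwz (Finset.mem_inter.2 ⟨hw, h⟩), hzw⟩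
    rw [mem_pre, Finset.mem_singleton] at hw
    exact mem_pre.2 (hw ▸ mem_pre.1 (hBA hx))
  · push Not at hsplit
    have hBimage : ∀ {x}, h x ∈ B.image h → x ∈ B := fun {x} hx => by
      obtain ⟨z, hz, hzx⟩ := Finset.mem_image.1 hx
      exact hsplit z hz x hzx.symm
    obtain ⟨a, ha, b, hb, hba, hab⟩ := (conn_iff.1 hA).2 (B.image h)
      (Finset.image_subset_iff.2 fun x hx => (mem_pre (h := h)).1 (hBA hx)) (hBne.image h)
      fun heq => hne (hBA.antisymm fun x hx => hBimage (heq ▸ mem_pre.1 hx))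
    obtain ⟨-, x, y, rfl, rfl, hxy⟩ := adj_quot.1 hab
    exact ⟨x, hBimage ha, y, mem_pre.2 hb, fun hy => hba (Finset.mem_image_of_mem h hy), hxy⟩

theorem Packing.of_quot [Fintype W] [DecidableEq V] (hr : 0 < r)
    (hp : (G.quot h).Packing K r)
    (hfiber : ∀ a ∈ (G.quot h).support, G.Conn (pre h {a})) : G.Packing K r := by
  obtain ⟨P, Q, hmodel, hdisj⟩ := hp
  have hsupp : ∀ i, P i ∪ Q i ⊆ (G.quot h).support := fun i => (hmodel i).union_subset_support hr
  have hpre : ∀ A B : Finset W,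
      Multigraph.pre h A ∪ Multigraph.pre h B = Multigraph.pre h (A ∪ B) := fun A B => by ext; simp
  refine ⟨fun i => Multigraph.pre h (P i), fun i => Multigraph.pre h (Q i), fun i => ?_, ?_⟩
  · exact ⟨(hmodel i).conn_left.pre fun a ha => hfiber a (hsupp i (Finset.mem_union_left _ ha)),
      (hmodel i).conn_right.pre fun a ha => hfiber a (hsupp i (Finset.mem_union_right _ ha)),
      disjoint_pre (hmodel i).disjoint,
      (hmodel i).le_edges.trans_eq (edges_quot (hmodel i).disjoint)⟩
  · intro i j hij
    dsimp only
    rw [hpre, hpre]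
    exact disjoint_pre (hdisj hij)

end Quot

end Basic

section Tangled

variable {V : Type*} [Fintype V] [DecidableEq V] {G : Multigraph V} {p : V → ℕ} {t m m' : ℕ}
  {S Z M : Finset V} {c : V → ℕ} {u v x y : V}

/-- Twice the number of edges between vertices outside `S` of different colours. -/
def cut (G : Multigraph V) (S : Finset V) (c : V → ℕ) : ℕ :=
  ∑ x, ∑ y, (if x ∉ S ∧ y ∉ S ∧ c x ≠ c y then 1 else 0) * G.mult x y

/-- If vertices have removal cost `t` and edges have removal cost `1`, then after any removal of
cost less than `m` the remaining vertices cannot be split into parts, each of weight at most half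
the total, that are pairwise joined by no edge. This is the shape in which large treewidth is passed
on to smaller graphs. -/
def Tangled (G : Multigraph V) (p : V → ℕ) (t m : ℕ) : Prop :=
  ∀ (S : Finset V) (c : V → ℕ), 2 * (t * S.card) + G.cut S c < 2 * m →
    ∃ a, ∑ x, p x < 2 * ∑ x with x ∉ S ∧ c x = a, p x

/-- The multigraph obtained by identifying `v` with `u`. -/
def contract (G : Multigraph V) (u v : V) : Multigraph V := G.quot (Function.update id v u)

/-- The push-forward of a vertex weight along a map. -/
def pushWeight (h : V → V) (p : V → ℕ) (a : V) : ℕ := ∑ x with h x = a, p x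

theorem sum_pushWeight (h : V → V) (p : V → ℕ) : ∑ a, pushWeight h p a = ∑ x, p x :=
  Finset.sum_fiberwise _ _ _

theorem Tangled.two_mul_sum_le (hT : G.Tangled p t m) (hZ : t * Z.card < m) :
    2 * ∑ x ∈ Z, p x ≤ ∑ x, p x := by
  obtain ⟨a, ha⟩ := hT Z (fun _ => 0) (by simp [cut]; lia)
  have hcompl : ∑ x with x ∉ Z ∧ 0 = a, p x ≤ ∑ x ∈ Zᶜ, p x :=
    Finset.sum_le_sum_of_subset fun x hx => by grind [Finset.mem_compl]
  have htotal := Finset.sum_add_sum_compl Z p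
  lia

theorem Tangled.del (hT : G.Tangled p t m) (hm : m' + t * M.card ≤ m) :
    (G.del M).Tangled p t m' := by
  intro S c hc
  have hcut : G.cut (S ∪ M) c ≤ (G.del M).cut S c := by
    refine Finset.sum_le_sum fun x _ => Finset.sum_le_sum fun y _ => ?_
    by_cases h : x ∈ M ∨ y ∈ M
    · rw [if_neg (by grind), zero_mul]
      exact Nat.zero_le _
    · rw [not_or] at h
      simp [mult_del_of_notMem h.1 h.2, h.1, h.2]
  have hcard : t * (S ∪ M).card ≤ t * S.card + t * M.card := by
    rw [← mul_add]
    exact Nat.mul_le_mul_left _ (Finset.card_union_le _ _)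
  obtain ⟨a, ha⟩ := hT (S ∪ M) c (by lia)
  exact ⟨a, ha.trans_le (Nat.mul_le_mul_left _ (Finset.sum_le_sum_of_subset fun x hx => by grind))⟩

theorem Tangled.support_nonempty (hT : G.Tangled p t m) (hm : t < m) : G.support.Nonempty := by
  by_contra! hempty
  have hmult : ∀ x y, G.mult x y = 0 := fun x y => Nat.eq_zero_of_not_pos fun h =>
    Finset.notMem_empty x (hempty ▸ left_mem_support (G := G) h)
  let e := Fintype.equivFin V
  obtain ⟨a, ha⟩ := hT ∅ (fun x => e x) (by simp [cut, hmult]; lia)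
  have hsingle : ({x | x ∉ (∅ : Finset V) ∧ (e x : ℕ) = a} : Finset V).card ≤ 1 :=
    Finset.card_le_one.2 fun x hx y hy => e.injective (Fin.ext (by grind))
  have hlight := hT.two_mul_sum_le (Nat.mul_le_mul_left t hsingle |>.trans_lt (by lia))
  lia

theorem Tangled.exists_lt_of_quot {h : V → V} (hT : G.Tangled p t m)
    (hS : (pre h S).card ≤ S.card) (hc : 2 * (t * S.card) + (G.quot h).cut S c < 2 * m) :
    ∃ a, ∑ x, pushWeight h p x < 2 * ∑ x with x ∉ S ∧ c x = a, pushWeight h p x := by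
  have hcut : (G.quot h).cut S c = G.cut (pre h S) (c ∘ h) := by
    rw [cut, cut, sum_quot (fun a b => if a ∉ S ∧ b ∉ S ∧ c a ≠ c b then 1 else 0) (by simp)]
    simp only [mem_pre, Function.comp_apply]
  have hcard := Nat.mul_le_mul_left t hS
  obtain ⟨a, ha⟩ := hT (pre h S) (c ∘ h) (by lia)
  refine ⟨a, ?_⟩
  simp_rw [pushWeight, ← sum_pre]
  convert ha using 3
  · ext; simp
  · ext; simp

theorem mult_contract (hx : x ≠ u ∧ x ≠ v) (hy : y ≠ u ∧ y ≠ v) :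
    (G.contract u v).mult x y = G.mult x y := by
  obtain rfl | hxy := eq_or_ne x y
  · rw [mult_self, mult_self]
  have hfiber : ∀ z, z ≠ u ∧ z ≠ v → ({w | Function.update id v u w = z} : Finset V) = {z} := by
    intro z hz
    ext w
    simp only [Finset.mem_filter_univ, Finset.mem_singleton, Function.update_apply]
    grind
  rw [contract, mult_quot_of_ne hxy, hfiber x hx, hfiber y hy, Finset.sum_singleton,
    Finset.sum_singleton]

theorem edges_eq_sum (P Q : Finset V) :
    G.edges P Q = ∑ x, ∑ y, (if x ∈ P ∧ y ∈ Q then 1 else 0) * G.mult x y := by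
  simp [edges, ite_and]

theorem cut_sdiff_le_cut_contract (hu : u ∈ S) (hv : v ∈ Z) (c : V → ℕ) :
    G.cut (S \ Z) (fun x => if x ∈ Z then 0 else c x + 1) ≤
      (G.contract u v).cut S c + 2 * G.edges Z (S ∪ Z)ᶜ := by
  have hsymm : 2 * G.edges Z (S ∪ Z)ᶜ = G.edges (S ∪ Z)ᶜ Z + G.edges Z (S ∪ Z)ᶜ := by
    rw [two_mul, edges_comm (S ∪ Z)ᶜ]
  rw [hsymm, edges_eq_sum, edges_eq_sum]
  simp only [cut, ← Finset.sum_add_distrib]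
  refine Finset.sum_le_sum fun x _ => Finset.sum_le_sum fun y _ => ?_
  by_cases hxy : x ∈ Z ∨ y ∈ Z
  · have hind : (if x ∉ S \ Z ∧ y ∉ S \ Z ∧
          (if x ∈ Z then 0 else c x + 1) ≠ if y ∈ Z then 0 else c y + 1 then 1 else 0) ≤
        (if x ∈ (S ∪ Z)ᶜ ∧ y ∈ Z then 1 else 0) + if x ∈ Z ∧ y ∈ (S ∪ Z)ᶜ then 1 else 0 := by
      simp only [Finset.mem_compl, Finset.mem_union, Finset.mem_sdiff]
      grind
    refine (Nat.mul_le_mul_right _ hind).trans ?_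
    rw [add_mul]
    lia
  · rw [not_or] at hxy
    by_cases hS : x ∈ S ∨ y ∈ S
    · rw [if_neg (by grind), zero_mul]
      exact Nat.zero_le _
    · rw [mult_contract (by grind) (by grind)]
      simp [hxy]

theorem Tangled.contract (hT : G.Tangled p t m) (hv : v ∈ Z) (hZ : t * Z.card < m)
    (hcost : ∀ S, u ∈ S → t * (S \ Z).card + G.edges Z (S ∪ Z)ᶜ ≤ t * S.card) :
    (G.contract u v).Tangled (pushWeight (Function.update id v u) p) t m := by
  intro S c hc
  by_cases hu : u ∈ S
  · have hcut := cut_sdiff_le_cut_contract (G := G) hu hv c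
    have hcostS := hcost S hu
    obtain ⟨_ | a, ha⟩ := hT (S \ Z) (fun x => if x ∈ Z then 0 else c x + 1) (by lia)
    · have hZle : ∑ x with x ∉ S \ Z ∧ (if x ∈ Z then 0 else c x + 1) = 0, p x ≤ ∑ x ∈ Z, p x :=
        Finset.sum_le_sum_of_subset fun x hx => by grind
      have hlight := hT.two_mul_sum_le hZ
      lia
    · have hmem : ∀ x, (x ∉ S \ Z ∧ (if x ∈ Z then 0 else c x + 1) = a + 1) →
          x ∉ Z ∧ x ∉ S ∧ c x = a := fun x hx => by
        by_cases hxZ : x ∈ Z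
        · simp [hxZ] at hx
        · simpa [hxZ] using hx
      rw [← sum_pushWeight (Function.update id v u) p] at ha
      refine ⟨a, ha.trans_le (Nat.mul_le_mul_left _ ?_)⟩
      refine (Finset.sum_le_sum fun x hx => ?_).trans <|
        Finset.sum_le_sum_of_subset (Finset.monotone_filter_right _ fun x _ hx => (hmem x hx).2)
      have hxv : x ≠ v := fun h => (hmem x ((Finset.mem_filter_univ x).1 hx)).1 (h ▸ hv)
      refine Finset.single_le_sum (f := p) (fun _ _ => Nat.zero_le _) ?_
      rw [Finset.mem_filter_univ]
      exact Function.update_of_ne hxv _ _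
  · refine hT.exists_lt_of_quot (Finset.card_le_card fun x hx => ?_) hc
    rw [mem_pre, Function.update_apply] at hx
    split_ifs at hx
    exacts [absurd hx hu, hx]

theorem Tangled.contract_of_edges_le (hT : G.Tangled p t m) (huv : u ≠ v) (hm : 2 * t < m)
    (he : G.edges {u, v} {u, v}ᶜ ≤ t) :
    (G.contract u v).Tangled (pushWeight (Function.update id v u) p) t m := by
  refine hT.contract (Z := {u, v}) (by simp) (by grind) fun S hS => ?_
  have hcard : (S \ {u, v}).card + 1 ≤ S.card := Finset.card_lt_card <|
    (Finset.ssubset_iff_of_subset Finset.sdiff_subset).2 ⟨u, hS, by simp⟩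
  have hedges : G.edges {u, v} (S ∪ {u, v})ᶜ ≤ G.edges {u, v} {u, v}ᶜ :=
    edges_mono le_rfl (Finset.compl_subset_compl.2 Finset.subset_union_right)
  have hcost := Nat.mul_le_mul_left t hcard
  rw [mul_add] at hcost
  lia

theorem Tangled.contract_of_forall_adj (hT : G.Tangled p t m) (hm : t < m)
    (hv : ∀ x, G.simple.Adj v x → x = u) :
    (G.contract u v).Tangled (pushWeight (Function.update id v u) p) t m := by
  refine hT.contract (Z := {v}) (by simp) (by simpa) fun S hS => ?_
  have hedges : G.edges {v} (S ∪ {v})ᶜ = 0 := by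
    by_contra! h
    obtain ⟨x, hx, y, hy, hxy⟩ := edges_pos_iff.1 (Nat.pos_of_ne_zero h)
    rw [hv y (Finset.mem_singleton.1 hx ▸ hxy)] at hy
    simp [hS] at hy
  rw [hedges, add_zero]
  exact Nat.mul_le_mul_left t (Finset.card_le_card Finset.sdiff_subset)

theorem support_contract_subset (huv : G.simple.Adj u v) :
    (G.contract u v).support ⊆ G.support.erase v := fun x hx => by
  obtain ⟨y, hxy⟩ := mem_support.1 hx
  obtain ⟨-, a, b, ha, -, hab⟩ := adj_quot.1 hxy
  rw [Function.update_apply] at ha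
  have := huv.ne
  have := left_mem_support huv
  have := left_mem_support hab
  grind

theorem Packing.of_contract {K r : ℕ} (hr : 0 < r) (huv : G.simple.Adj u v)
    (hp : (G.contract u v).Packing K r) : G.Packing K r := by
  refine Packing.of_quot hr hp fun a ha => ?_
  have hav : a ≠ v := Finset.ne_of_mem_erase (support_contract_subset huv ha)
  obtain rfl | hau := eq_or_ne a u
  · convert conn_pair huv
    ext x
    simp only [mem_pre, Function.update_apply]
    grind
  · convert conn_singleton a
    ext x
    simp only [mem_pre, Function.update_apply]
    grind

end Tangled

section Dense

variable {V : Type*} [Fintype V] {G : Multigraph V} {M : Finset V} {K r : ℕ} {u v x y : V}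

theorem support_nonempty_of_card_edgeFinset_pos (h : 0 < G.simple.edgeFinset.card) :
    G.support.Nonempty := by
  obtain ⟨e, he⟩ := Finset.card_pos.1 h
  induction e with | _ x y
  exact ⟨x, left_mem_support (SimpleGraph.mem_edgeFinset.1 he)⟩

variable [DecidableEq V]

theorem contract_adj_of_adj (hxy : G.simple.Adj x y) (hx : x ≠ v) (hy : y ≠ v) :
    (G.contract u v).simple.Adj x y :=
  adj_quot.2 ⟨hxy.ne, x, y, Function.update_of_ne hx _ _, Function.update_of_ne hy _ _, hxy⟩

theorem contract_adj_of_adj_right (hvy : G.simple.Adj v y) (hy : y ≠ u) :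
    (G.contract u v).simple.Adj u y :=
  adj_quot.2 ⟨hy.symm, v, y, Function.update_self .., Function.update_of_ne hvy.ne' _ _, hvy⟩

theorem card_edgeFinset_le_card_contract_add (u v : V) :
    G.simple.edgeFinset.card ≤ (G.contract u v).simple.edgeFinset.card +
      (G.simple.neighborFinset u ∩ G.simple.neighborFinset v).card + 1 := by
  let C := G.simple.neighborFinset u
  let D := G.simple.neighborFinset v
  let new := (D \ insert u C).image fun y => s(u, y)
  have hnew : new.card = (D \ insert u C).card :=
    Finset.card_image_of_injective _ (Sym2.mkEmbedding u).injective
  have hsub : (G.simple.deleteIncidenceSet v).edgeFinset ∪ new ⊆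
      (G.contract u v).simple.edgeFinset := by
    refine Finset.union_subset (fun e => ?_) (Finset.image_subset_iff.2 fun y hy => ?_)
    · induction e with | _ x y
      simp only [SimpleGraph.mem_edgeFinset, SimpleGraph.mem_edgeSet,
        SimpleGraph.deleteIncidenceSet_adj]
      exact fun ⟨hxy, hx, hy⟩ => contract_adj_of_adj hxy hx hy
    · simp only [C, D, Finset.mem_sdiff, Finset.mem_insert, SimpleGraph.mem_neighborFinset,
        not_or] at hy
      exact SimpleGraph.mem_edgeFinset.2 (contract_adj_of_adj_right hy.1 hy.2.1)
  have hdisj : Disjoint (G.simple.deleteIncidenceSet v).edgeFinset new := by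
    refine Finset.disjoint_right.2 fun e he he' => ?_
    obtain ⟨y, hy, rfl⟩ := Finset.mem_image.1 he
    rw [SimpleGraph.mem_edgeFinset, SimpleGraph.mem_edgeSet,
      SimpleGraph.deleteIncidenceSet_adj] at he'
    simp [C, he'.1] at hy
  have hcard := Finset.card_le_card hsub
  rw [Finset.card_union_of_disjoint hdisj, hnew,
    G.simple.card_edgeFinset_deleteIncidenceSet] at hcard
  have hD : D.card ≤ (D \ insert u C).card + ((C ∩ D).card + 1) := by
    have hsplit := Finset.card_sdiff_add_card_inter D (insert u C)
    have hinter : (D ∩ insert u C).card ≤ (insert u (C ∩ D)).card :=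
      Finset.card_le_card fun y hy => by grind
    have hinsert := Finset.card_insert_le u (C ∩ D)
    lia
  have hdeg : D.card = G.simple.degree v := rfl
  lia

theorem card_edgeFinset_le_card_del_add (M : Finset V) :
    G.simple.edgeFinset.card ≤
      (G.del M).simple.edgeFinset.card + M.card * G.support.card := by
  have hsub : G.simple.edgeFinset ⊆ (G.del M).simple.edgeFinset ∪
      (M ×ˢ G.support).image fun p => s(p.1, p.2) := fun e => by
    induction e with | _ x y
    simp only [SimpleGraph.mem_edgeFinset, SimpleGraph.mem_edgeSet, Finset.mem_union, adj_del,
      Finset.mem_image, Finset.mem_product]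
    intro hxy
    by_cases hx : x ∈ M
    · exact .inr ⟨(x, y), ⟨hx, right_mem_support hxy⟩, rfl⟩
    by_cases hy : y ∈ M
    · exact .inr ⟨(y, x), ⟨hy, left_mem_support hxy⟩, Sym2.eq_swap⟩
    · exact .inl ⟨hx, hy, hxy⟩
  refine (Finset.card_le_card hsub).trans ((Finset.card_union_le _ _).trans ?_)
  exact Nat.add_le_add_left (Finset.card_image_le.trans_eq (Finset.card_product _ _)) _

theorem exists_isModel_of_le_card_inter_neighborFinset (huv : G.simple.Adj u v)
    (hr : r ≤ (G.simple.neighborFinset u ∩ G.simple.neighborFinset v).card) :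
    ∃ P Q, G.IsModel r P Q ∧ (P ∪ Q).card ≤ r + 2 := by
  obtain ⟨C, hC, rfl⟩ := Finset.exists_subset_card_eq hr
  simp only [Finset.subset_iff, Finset.mem_inter, SimpleGraph.mem_neighborFinset] at hC
  refine ⟨{u} ∪ C, {v}, ⟨?_, conn_singleton v, ?_, ?_⟩, ?_⟩
  · exact (conn_singleton u).union_of_forall_adj fun y hy _ => ⟨u, by simp, (hC hy).1⟩
  · rw [Finset.disjoint_singleton_right, Finset.mem_union, Finset.mem_singleton, not_or]
    exact ⟨huv.ne', fun h => (hC h).2.ne rfl⟩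
  · calc C.card = ∑ _y ∈ C, 1 := Finset.card_eq_sum_ones C
      _ ≤ G.edges C {v} := Finset.sum_le_sum fun y hy =>
        (hC hy).2.symm.trans_eq (Finset.sum_singleton _ _).symm
      _ ≤ G.edges ({u} ∪ C) {v} := edges_mono Finset.subset_union_right le_rfl
  · grind

theorem packing_of_dense (hr : 0 < r) (K : ℕ) (G : Multigraph V) (hne : G.support.Nonempty)
    (hG : K * (r + 2) * G.support.card ≤ G.simple.edgeFinset.card) : G.Packing K r := by
  induction K generalizing G with
  | zero => exact packing_zero r
  | succ K ihK =>
    induction hN : G.support.card using Nat.strong_induction_on generalizing G with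
    | _ N ih =>
      subst hN
      obtain ⟨u, hu⟩ := hne
      obtain ⟨v, huv⟩ := mem_support.1 hu
      have hpos : 0 < G.support.card := Finset.card_pos.2 ⟨u, hu⟩
      by_cases hcommon : r ≤ (G.simple.neighborFinset u ∩ G.simple.neighborFinset v).card
      · obtain ⟨P, Q, hPQ, hcard⟩ := exists_isModel_of_le_card_inter_neighborFinset huv hcommon
        refine .succ_of_del hr hPQ ?_
        obtain rfl | hK := K.eq_zero_or_pos
        · exact packing_zero r
        have hdel : K * (r + 2) * G.support.card ≤ (G.del (P ∪ Q)).simple.edgeFinset.card := by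
          have hedges := card_edgeFinset_le_card_del_add (G := G) (P ∪ Q)
          have hM := Nat.mul_le_mul_right G.support.card hcard
          lia
        refine ihK _ (support_nonempty_of_card_edgeFinset_pos (lt_of_lt_of_le ?_ hdel)) ?_
        · exact Nat.mul_pos (Nat.mul_pos hK (by lia)) hpos
        · refine (Nat.mul_le_mul_left _ (Finset.card_le_card ?_)).trans hdel
          exact support_del_subset.trans Finset.sdiff_subset
      · have hedges := card_edgeFinset_le_card_contract_add (G := G) u v
        have hsupp := (Finset.card_le_card (support_contract_subset huv)).trans_lt
          (Finset.card_erase_lt_of_mem (right_mem_support huv))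
        have hstep : (K + 1) * (r + 2) * (G.contract u v).support.card + (r + 2) ≤
            (K + 1) * (r + 2) * G.support.card := calc
          _ ≤ (K + 1) * (r + 2) * (G.contract u v).support.card + (K + 1) * (r + 2) :=
            Nat.add_le_add_left (Nat.le_mul_of_pos_left _ K.succ_pos) _
          _ = (K + 1) * (r + 2) * ((G.contract u v).support.card + 1) := (Nat.mul_succ _ _).symm
          _ ≤ (K + 1) * (r + 2) * G.support.card := Nat.mul_le_mul_left _ hsupp
        exact .of_contract hr huv (ih _ hsupp _
          (support_nonempty_of_card_edgeFinset_pos (by lia)) (by lia) rfl)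

end Dense

section Near

variable {V : Type*} {G : Multigraph V} {A B S X : Finset V} {c c' v x y : V} {q r s R R' : ℕ}

/-- Every vertex of `A` lies together with `c` in a connected subset of `A` with at most `R + 1`
vertices. Such sets are the branch sets from which small models are cut out. -/
structure Near (G : Multigraph V) (c : V) (R : ℕ) (A : Finset V) : Prop where
  mem : c ∈ A
  exists_conn : ∀ x ∈ A, ∃ P ⊆ A, G.Conn P ∧ c ∈ P ∧ x ∈ P ∧ P.card ≤ R + 1

theorem near_singleton (v : V) : G.Near v 0 {v} :=
  ⟨Finset.mem_singleton_self v, fun _ hx =>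
    ⟨{v}, le_rfl, conn_singleton v, Finset.mem_singleton_self v, hx, by simp⟩⟩

theorem Near.exists_conn_superset (h : G.Near c R A) (hX : X ⊆ A) :
    ∃ P ⊆ A, G.Conn P ∧ c ∈ P ∧ X ⊆ P ∧ P.card ≤ 1 + R * X.card := by
  classical
  induction X using Finset.induction_on with
  | empty => exact ⟨{c}, by simpa using h.mem, conn_singleton c, by simp, by simp, by simp⟩
  | insert x X hx ih =>
    obtain ⟨P, hPA, hP, hcP, hXP, hPcard⟩ := ih ((Finset.subset_insert _ _).trans hX)
    obtain ⟨Q, hQA, hQ, hcQ, hxQ, hQcard⟩ := h.exists_conn x (hX (Finset.mem_insert_self _ _))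
    refine ⟨P ∪ Q, Finset.union_subset hPA hQA, hP.union hQ hcP hcQ,
      Finset.mem_union_left _ hcP, Finset.insert_subset (Finset.mem_union_right _ hxQ)
        (hXP.trans Finset.subset_union_left), ?_⟩
    have hunion := Finset.card_union_add_card_inter P Q
    have hinter : 0 < (P ∩ Q).card := Finset.card_pos.2 ⟨c, Finset.mem_inter.2 ⟨hcP, hcQ⟩⟩
    rw [Finset.card_insert_of_notMem hx, mul_add]
    lia

theorem Near.conn (h : G.Near c R A) : G.Conn A := by
  obtain ⟨P, hPA, hP, -, hAP, -⟩ := h.exists_conn_superset le_rfl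
  rwa [hPA.antisymm hAP] at hP

theorem edges_eq_sum_product (A B : Finset V) :
    G.edges A B = ∑ p ∈ A ×ˢ B, G.mult p.1 p.2 :=
  (Finset.sum_product' A B _).symm

theorem exists_adj_pairs_of_le_edges (h : r ≤ G.edges A B) :
    ∃ T ⊆ A ×ˢ B, T.card ≤ r ∧ (∀ p ∈ T, G.simple.Adj p.1 p.2) ∧
      r ≤ ∑ p ∈ T, G.mult p.1 p.2 := by
  let S := (A ×ˢ B).filter fun p => G.simple.Adj p.1 p.2
  have hsum : G.edges A B = ∑ p ∈ S, G.mult p.1 p.2 := by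
    rw [edges_eq_sum_product]
    exact (Finset.sum_filter_of_ne fun p _ hp => Nat.pos_of_ne_zero hp).symm
  by_cases hS : S.card ≤ r
  · exact ⟨S, Finset.filter_subset _ _, hS, fun p hp => (Finset.mem_filter.1 hp).2, hsum ▸ h⟩
  · obtain ⟨T, hT, rfl⟩ := Finset.exists_subset_card_eq (not_le.1 hS).le
    have hadj : ∀ p ∈ T, G.simple.Adj p.1 p.2 := fun p hp => (Finset.mem_filter.1 (hT hp)).2
    refine ⟨T, hT.trans (Finset.filter_subset _ _), le_rfl, hadj, ?_⟩
    rw [Finset.card_eq_sum_ones]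
    exact Finset.sum_le_sum hadj

theorem NoSmallModel.edges_lt (h : G.NoSmallModel r s) (hA : G.Near c R A) (hB : G.Near c' R' B)
    (hAB : Disjoint A B) (hs : 2 + R * r + R' * r ≤ s) : G.edges A B < r := by
  classical
  by_contra! hr
  obtain ⟨T, hT, hTcard, -, hTr⟩ := exists_adj_pairs_of_le_edges hr
  obtain ⟨P, hPA, hP, -, hTP, hPcard⟩ := hA.exists_conn_superset (X := T.image Prod.fst)
    (Finset.image_subset_iff.2 fun p hp => (Finset.mem_product.1 (hT hp)).1)
  obtain ⟨Q, hQB, hQ, -, hTQ, hQcard⟩ := hB.exists_conn_superset (X := T.image Prod.snd)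
    (Finset.image_subset_iff.2 fun p hp => (Finset.mem_product.1 (hT hp)).2)
  have hTPQ : T ⊆ P ×ˢ Q := fun p hp => Finset.mem_product.2
    ⟨hTP (Finset.mem_image_of_mem _ hp), hTQ (Finset.mem_image_of_mem _ hp)⟩
  have hPQ : G.IsModel r P Q := ⟨hP, hQ, Finset.disjoint_of_subset_left hPA
    (Finset.disjoint_of_subset_right hQB hAB), hTr.trans <|
      (Finset.sum_le_sum_of_subset hTPQ).trans_eq (edges_eq_sum_product P Q).symm⟩
  have hfst : R * (T.image Prod.fst).card ≤ R * r :=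
    Nat.mul_le_mul_left _ (Finset.card_image_le.trans hTcard)
  have hsnd : R' * (T.image Prod.snd).card ≤ R' * r :=
    Nat.mul_le_mul_left _ (Finset.card_image_le.trans hTcard)
  have hlarge := h P Q hPQ
  lia

theorem NoSmallModel.mult_le (h : G.NoSmallModel (q + 1) s) (hs : 2 ≤ s) (x y : V) :
    G.mult x y ≤ q := by
  obtain rfl | hxy := eq_or_ne x y
  · rw [mult_self]
    exact q.zero_le
  · rw [← edges_singleton x y]
    exact Nat.le_of_lt_succ <| h.edges_lt (near_singleton x) (near_singleton y)
      (Finset.disjoint_singleton.2 hxy) (by simpa using hs)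

end Near

section StarShaped

variable {V : Type*} {G : Multigraph V} {A B S X : Finset V} {c v x y : V} {q r s R : ℕ}

/-- `B` contains with each of its vertices the predecessor on some shortest path from `c`. Since the
distance to a vertex not reachable from `c` is `0` by convention, all vertices of `B` are reachable
from `c`. -/
structure StarShaped (G : Multigraph V) (c : V) (B : Finset V) : Prop where
  mem : c ∈ B
  exists_adj : ∀ v ∈ B, v ≠ c →
    ∃ u ∈ B, G.simple.Adj u v ∧ G.simple.dist c v = G.simple.dist c u + 1

theorem StarShaped.near_filter (h : G.StarShaped c B) (R : ℕ) :
    G.Near c R {v ∈ B | G.simple.dist c v ≤ R} := by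
  classical
  suffices H : ∀ d ≤ R, ∀ v ∈ B, G.simple.dist c v = d →
      ∃ P ⊆ {v ∈ B | G.simple.dist c v ≤ R}, G.Conn P ∧ c ∈ P ∧ v ∈ P ∧ P.card ≤ d + 1 by
    refine ⟨by simp [h.mem], fun v hv => ?_⟩
    obtain ⟨hvB, hvR⟩ := Finset.mem_filter.1 hv
    obtain ⟨P, hPB, hP, hcP, hvP, hPcard⟩ := H _ hvR v hvB rfl
    exact ⟨P, hPB, hP, hcP, hvP, hPcard.trans (Nat.succ_le_succ hvR)⟩
  intro d hd
  induction d with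
  | zero =>
    intro v hv hdist
    obtain rfl | hvc := eq_or_ne v c
    · exact ⟨{v}, by simp [h.mem], conn_singleton v, by simp, by simp, by simp⟩
    · obtain ⟨u, -, -, hu⟩ := h.exists_adj v hv hvc
      lia
  | succ d ih =>
    intro v hv hdist
    obtain ⟨u, hu, huv, hdu⟩ := h.exists_adj v hv (by rintro rfl; simp at hdist)
    obtain ⟨P, hPB, hP, hcP, huP, hPcard⟩ := ih (by lia) u hu (by lia)
    exact ⟨insert v P, Finset.insert_subset (Finset.mem_filter.2 ⟨hv, by lia⟩) hPB,
      hP.insert huP huv, Finset.mem_insert_of_mem hcP, Finset.mem_insert_self _ _,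
      (Finset.card_insert_le v P).trans (Nat.succ_le_succ hPcard)⟩

theorem StarShaped.near (h : G.StarShaped c B) (hR : ∀ v ∈ B, G.simple.dist c v ≤ R) :
    G.Near c R B := by
  simpa [Finset.filter_true_of_mem hR] using h.near_filter R

theorem StarShaped.exists_isModel (h : G.StarShaped c B) (hX : G.Conn X)
    (hXB : ∀ v ∈ X, v ∈ B ∧ G.simple.dist c v = R + 1) :
    ∃ P, G.IsModel X.card P X ∧ P.card ≤ 1 + R * X.card := by
  classical
  have hparent : ∀ v ∈ X, ∃ u ∈ {v ∈ B | G.simple.dist c v ≤ R}, G.simple.Adj u v := fun v hv => by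
    obtain ⟨hvB, hdist⟩ := hXB v hv
    obtain ⟨u, hu, huv, hdu⟩ := h.exists_adj v hvB (by rintro rfl; simp at hdist)
    exact ⟨u, Finset.mem_filter.2 ⟨hu, by lia⟩, huv⟩
  choose! parent hparentB hadj using hparent
  obtain ⟨P, hPB, hP, -, hXP, hPcard⟩ := (h.near_filter R).exists_conn_superset
    (Finset.image_subset_iff.2 hparentB)
  refine ⟨P, ⟨hP, hX, Finset.disjoint_left.2 fun v hvP hvX => ?_, ?_⟩,
    hPcard.trans (Nat.add_le_add_left (Nat.mul_le_mul_left R Finset.card_image_le) 1)⟩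
  · have hle := (Finset.mem_filter.1 (hPB hvP)).2
    have heq := (hXB v hvX).2
    lia
  · rw [edges_comm, Finset.card_eq_sum_ones]
    exact Finset.sum_le_sum fun v hv => (hadj v hv).symm.trans_le <|
      Finset.single_le_sum (f := G.mult v) (fun _ _ => Nat.zero_le _)
        (hXP (Finset.mem_image_of_mem parent hv))

theorem edges_le_card_mul (hm : ∀ x y, G.mult x y ≤ q) (v : V) (A : Finset V) :
    G.edges {v} A ≤ {x ∈ A | G.simple.Adj v x}.card * q := by
  rw [edges, Finset.sum_singleton,
    ← Finset.sum_filter_of_ne (p := G.simple.Adj v) fun x _ hx => Nat.pos_of_ne_zero hx]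
  exact Finset.sum_le_card_nsmul _ _ _ fun x _ => hm v x

theorem StarShaped.eq_of_dist_eq_zero (h : G.StarShaped c B) (hv : v ∈ B)
    (hd : G.simple.dist c v = 0) : v = c := by
  by_contra hvc
  obtain ⟨u, -, -, hu⟩ := h.exists_adj v hv hvc
  lia

theorem StarShaped.edges_layer_le (h : G.StarShaped c B) (hns : G.NoSmallModel (q + 1) s)
    (hv : v ∈ B) (hs : 2 + G.simple.dist c v * (q + 1) ≤ s) :
    G.edges {v} {w ∈ B | G.simple.dist c w = G.simple.dist c v} ≤ q * q := by
  classical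
  refine (edges_le_card_mul (hns.mult_le (by lia)) v _).trans (Nat.mul_le_mul_right q ?_)
  by_contra! hcard
  obtain ⟨w₀, hw₀⟩ := Finset.card_pos.1 (q.zero_le.trans_lt hcard)
  obtain ⟨X, hX, hXcard⟩ := Finset.exists_subset_card_eq hcard.le
  have hXB : ∀ w ∈ X, (w ∈ B ∧ G.simple.dist c w = G.simple.dist c v) ∧ G.simple.Adj v w :=
    fun w hw => by simpa using hX hw
  have hlayer : ∀ w ∈ {v} ∪ X, w ∈ B ∧ G.simple.dist c w = G.simple.dist c v := fun w hw => by
    obtain hw | hw := Finset.mem_union.1 hw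
    · rw [Finset.mem_singleton.1 hw]
      exact ⟨hv, rfl⟩
    · exact (hXB w hw).1
  have hconn : G.Conn ({v} ∪ X) :=
    (conn_singleton v).union_of_forall_adj fun w hw _ => ⟨v, by simp, (hXB w hw).2⟩
  have hvX : Disjoint {v} X := Finset.disjoint_singleton_left.2 fun hvX => (hXB v hvX).2.ne rfl
  have hcard' : ({v} ∪ X).card = q + 1 := by
    rw [Finset.card_union_of_disjoint hvX, Finset.card_singleton, hXcard, add_comm]
  cases hd : G.simple.dist c v with
  | zero =>
    obtain ⟨⟨hw₀B, hdw₀⟩, hvw₀⟩ : (w₀ ∈ B ∧ G.simple.dist c w₀ = G.simple.dist c v) ∧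
      G.simple.Adj v w₀ := by simpa using hw₀
    exact hvw₀.ne ((h.eq_of_dist_eq_zero hv hd).trans
      (h.eq_of_dist_eq_zero hw₀B (hdw₀.trans hd)).symm)
  | succ R =>
    obtain ⟨P, hP, hPcard⟩ := h.exists_isModel hconn fun w hw => hd ▸ hlayer w hw
    rw [hcard'] at hP hPcard
    have hlarge := hns _ _ hP
    rw [hd, add_mul] at hs
    lia

theorem sum_edges_filter_gt (B : Finset V) (d : V → ℕ) :
    ∑ v ∈ B, G.edges {v} {w ∈ B | d v < d w} = ∑ v ∈ B, G.edges {v} {w ∈ B | d w < d v} := by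
  simp only [edges, Finset.sum_singleton, Finset.sum_filter]
  rw [Finset.sum_comm]
  simp_rw [G.mult_comm]

theorem edges_self_eq_sum (B : Finset V) (d : V → ℕ) :
    G.edges B B = 2 * ∑ v ∈ B, G.edges {v} {w ∈ B | d w < d v} +
      ∑ v ∈ B, G.edges {v} {w ∈ B | d w = d v} := by
  rw [two_mul]
  nth_rw 2 [← sum_edges_filter_gt]
  simp only [edges, Finset.sum_singleton, Finset.sum_filter, ← Finset.sum_add_distrib]
  refine Finset.sum_congr rfl fun v _ => Finset.sum_congr rfl fun w _ => ?_
  obtain h | h | h := lt_trichotomy (d w) (d v)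
  · simp [h, h.ne, h.not_gt]
  · simp [h]
  · simp [h, h.ne', h.not_gt]

theorem StarShaped.edges_closer_le (h : G.StarShaped c B) (hns : G.NoSmallModel (q + 1) s)
    (hs : 2 + G.simple.dist c v * (q + 1) ≤ s) :
    G.edges {v} {w ∈ B | G.simple.dist c w < G.simple.dist c v} ≤ q := by
  cases hd : G.simple.dist c v with
  | zero => simp [edges]
  | succ R =>
    simp only [Nat.lt_succ_iff]
    refine Nat.le_of_lt_succ (hns.edges_lt (near_singleton v) (h.near_filter R) ?_ ?_)
    · rw [Finset.disjoint_singleton_left, Finset.mem_filter, hd]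
      exact fun hv => (R.lt_succ_self.not_ge hv.2)
    · rw [hd, add_mul] at hs
      lia

theorem StarShaped.edges_self_le (h : G.StarShaped c B) (hns : G.NoSmallModel (q + 1) s)
    (hR : ∀ v ∈ B, G.simple.dist c v ≤ R) (hs : 2 + R * (q + 1) ≤ s) :
    G.edges B B ≤ B.card * (q * (q + 2)) := by
  have hsv : ∀ v ∈ B, 2 + G.simple.dist c v * (q + 1) ≤ s := fun v hv =>
    hs.trans' (Nat.add_le_add_left (Nat.mul_le_mul_right _ (hR v hv)) 2)
  have hcloser := Finset.sum_le_card_nsmul B _ q fun v hv => h.edges_closer_le hns (hsv v hv)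
  have hlayer := Finset.sum_le_card_nsmul B _ (q * q) fun v hv =>
    h.edges_layer_le hns hv (hsv v hv)
  rw [smul_eq_mul] at hcloser hlayer
  rw [edges_self_eq_sum B (G.simple.dist c)]
  linarith

theorem StarShaped.card_mul_le_edges_compl [Fintype V] [DecidableEq V] (h : G.StarShaped c B)
    (hns : G.NoSmallModel (q + 1) s) (hR : ∀ v ∈ B, G.simple.dist c v ≤ R)
    (hs : 2 + R * (q + 1) ≤ s) (hdeg : ∀ v ∈ B, q * (q + 3) ≤ G.deg v) :
    B.card * q ≤ G.edges B Bᶜ := by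
  have hself := h.edges_self_le hns hR hs
  have htotal : G.edges B B + G.edges B Bᶜ = ∑ v ∈ B, G.deg v := by
    rw [edges, edges, ← Finset.sum_add_distrib]
    exact Finset.sum_congr rfl fun v _ => Finset.sum_add_sum_compl B _
  have hsum := Finset.card_nsmul_le_sum B _ _ hdeg
  rw [smul_eq_mul] at hsum
  linarith

end StarShaped

section Dist

variable {V : Type*} {S : SimpleGraph V} {c u v : V} {i : ℕ}

theorem exists_adj_edist_eq_add_one (h : S.Reachable c v) (hvc : v ≠ c) :
    ∃ u, S.Adj u v ∧ S.edist c v = S.edist c u + 1 := by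
  obtain ⟨p, hp⟩ := h.exists_walk_length_eq_edist
  have hnil : ¬ p.Nil := fun hnil => hvc hnil.eq.symm
  refine ⟨p.penultimate, p.adj_penultimate hnil, le_antisymm ?_ ?_⟩
  · rw [← SimpleGraph.edist_eq_one_iff_adj.2 (p.adj_penultimate hnil)]
    exact SimpleGraph.edist_triangle
  · rw [← hp, ← p.length_dropLast_add_one hnil, Nat.cast_add, Nat.cast_one]
    gcongr
    exact p.dropLast.edist_le

theorem dist_eq_dist_add_one (hadj : S.Adj u v)
    (h : S.edist c v = S.edist c u + 1) (hv : S.Reachable c v) :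
    S.dist c v = S.dist c u + 1 := by
  rw [← hv.coe_dist_eq_edist, ← (hv.trans hadj.symm.reachable).coe_dist_eq_edist] at h
  exact_mod_cast h

theorem reachable_of_edist_le (h : S.edist c v ≤ i) : S.Reachable c v :=
  SimpleGraph.edist_ne_top_iff_reachable.1 (ne_top_of_le_ne_top (ENat.natCast_ne_top i) h)

theorem dist_le_of_edist_le (h : S.edist c v ≤ i) : S.dist c v ≤ i :=
  ENat.toNat_le_of_le_natCast h

end Dist

section Balls

variable {V : Type*} [Fintype V] {G : Multigraph V} {B : Finset V} {c v : V} {i q s : ℕ}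

open scoped Classical in
/-- The closed ball of radius `i` about `c`. Mathlib's `SimpleGraph.ball` is open. -/
noncomputable def ball (G : Multigraph V) (c : V) (i : ℕ) : Finset V :=
  {v | G.simple.edist c v ≤ i}

theorem mem_ball : v ∈ G.ball c i ↔ G.simple.edist c v ≤ i := by
  simp [ball]

theorem starShaped_ball (c : V) (i : ℕ) : G.StarShaped c (G.ball c i) := by
  refine ⟨by simp [mem_ball], fun v hv hvc => ?_⟩
  have hreach := reachable_of_edist_le (mem_ball.1 hv)
  obtain ⟨u, huv, hu⟩ := exists_adj_edist_eq_add_one hreach hvc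
  exact ⟨u, mem_ball.2 ((le_self_add.trans_eq hu.symm).trans (mem_ball.1 hv)), huv,
    dist_eq_dist_add_one huv hu hreach⟩

theorem StarShaped.subset_support (h : G.StarShaped c B) (hc : c ∈ G.support) :
    B ⊆ G.support := by
  intro v hv
  obtain rfl | hvc := eq_or_ne v c
  · exact hc
  · obtain ⟨u, -, huv, -⟩ := h.exists_adj v hv hvc
    exact right_mem_support huv

theorem edges_ball_compl_le [DecidableEq V] (hns : G.NoSmallModel (q + 1) s)
    (hs : 2 + i * (q + 1) ≤ s) :
    G.edges (G.ball c i) (G.ball c i)ᶜ ≤ (G.ball c (i + 1) \ G.ball c i).card * q := by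
  rw [edges_comm, edges, ← Finset.sum_subset (s₁ := G.ball c (i + 1) \ G.ball c i)]
  · refine Finset.sum_le_card_nsmul _ _ _ fun y hy => ?_
    have hy' := Finset.disjoint_singleton_left.2 (Finset.mem_sdiff.1 hy).2
    have hlt := hns.edges_lt (near_singleton y) ((starShaped_ball c i).near fun v hv =>
      dist_le_of_edist_le (mem_ball.1 hv)) hy' (by simpa using hs)
    rw [edges, Finset.sum_singleton] at hlt
    exact Nat.le_of_lt_succ hlt
  · exact fun y hy => Finset.mem_compl.2 (Finset.mem_sdiff.1 hy).2
  · refine fun y hy hy' => Finset.sum_eq_zero fun x hx => Nat.eq_zero_of_not_pos fun hyx => hy' ?_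
    refine Finset.mem_sdiff.2 ⟨mem_ball.2 ?_, Finset.mem_compl.1 hy⟩
    calc G.simple.edist c y ≤ G.simple.edist c x + G.simple.edist x y := SimpleGraph.edist_triangle
      _ ≤ i + 1 := add_le_add (mem_ball.1 hx)
        (SimpleGraph.edist_eq_one_iff_adj.2 (SimpleGraph.Adj.symm hyx)).le

theorem two_pow_le_card_ball (hq : 0 < q) (hns : G.NoSmallModel (q + 1) s)
    (hdeg : ∀ v ∈ G.support, q * (q + 3) ≤ G.deg v) (hc : c ∈ G.support)
    (hs : 2 + i * (q + 1) ≤ s) : 2 ^ i ≤ (G.ball c i).card := by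
  classical
  induction i with
  | zero => exact Finset.card_pos.2 ⟨c, (starShaped_ball c 0).mem⟩
  | succ i ih =>
    have hs' : 2 + i * (q + 1) ≤ s := hs.trans' (by gcongr; exact i.le_succ)
    have hball := starShaped_ball (G := G) c i
    have hexpand := hball.card_mul_le_edges_compl hns
      (fun v hv => dist_le_of_edist_le (mem_ball.1 hv)) hs'
      fun v hv => hdeg v (hball.subset_support hc hv)
    have hsphere : (G.ball c i).card ≤ (G.ball c (i + 1) \ G.ball c i).card :=
      Nat.le_of_mul_le_mul_right (hexpand.trans (edges_ball_compl_le hns hs')) hq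
    have hsub : G.ball c i ⊆ G.ball c (i + 1) := fun v hv =>
      mem_ball.2 ((mem_ball.1 hv).trans (by exact_mod_cast i.le_succ))
    calc 2 ^ (i + 1) = 2 ^ i + 2 ^ i := by rw [pow_succ, mul_two]
      _ ≤ (G.ball c (i + 1) \ G.ball c i).card + (G.ball c i).card :=
        add_le_add ((ih hs').trans hsphere) (ih hs')
      _ = (G.ball c (i + 1)).card := Finset.card_sdiff_add_card_eq_card hsub

end Balls

section Cells

variable {V : Type*} [Fintype V] {G : Multigraph V} {C : Finset V} {q r s K R ρ : ℕ}

theorem exists_centres (G : Multigraph V) (ρ : ℕ) : ∃ C : Finset V,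
    (C : Set V).PairwiseDisjoint (G.ball · ρ) ∧ ∀ v, ∃ c ∈ C, G.simple.edist c v ≤ 2 * ρ := by
  classical
  obtain ⟨C, hC, hmax⟩ := (Set.toFinite {C : Finset V |
    (C : Set V).PairwiseDisjoint (G.ball · ρ)}).exists_maximal ⟨∅, by simp⟩
  refine ⟨C, hC, fun v => ?_⟩
  by_contra! hfar
  have hdisj : ∀ c ∈ C, Disjoint (G.ball v ρ) (G.ball c ρ) := fun c hc => by
    refine Finset.disjoint_left.2 fun x hxv hxc => (hfar c hc).not_ge ?_
    calc G.simple.edist c v ≤ G.simple.edist c x + G.simple.edist x v := SimpleGraph.edist_triangle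
      _ ≤ ρ + ρ := add_le_add (mem_ball.1 hxc) (SimpleGraph.edist_comm.trans_le (mem_ball.1 hxv))
      _ = 2 * ρ := (two_mul _).symm
  have hinsert : ((insert v C : Finset V) : Set V).PairwiseDisjoint (G.ball · ρ) := by
    rw [Finset.coe_insert]
    exact hC.insert fun c hc _ => hdisj c hc
  have hvC : v ∈ C := hmax hinsert (Finset.subset_insert v C) (Finset.mem_insert_self v C)
  exact (hfar v hvC).not_ge (by simp)

theorem exists_starShaped_cells [DecidableEq V] (hC : ∀ v, ∃ c ∈ C, G.simple.Reachable c v) :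
    ∃ f : V → V, (∀ v, f v ∈ C) ∧ (∀ v, ∀ c ∈ C, G.simple.edist (f v) v ≤ G.simple.edist c v) ∧
      ∀ c ∈ C, G.StarShaped c (pre f {c}) := by
  -- Breaking ties by an enumeration of `V` lets a vertex and its predecessor on a shortest path
  -- choose the same centre.
  let key : V → V → ℕ∞ ×ₗ Fin (Fintype.card V) := fun c v =>
    toLex (G.simple.edist c v, Fintype.equivFin V c)
  have hmin : ∀ v, ∃ c ∈ C, ∀ d ∈ C, key c v ≤ key d v := fun v =>
    C.exists_min_image (key · v) ((hC v).imp fun _ => And.left)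
  choose f hfC hf using hmin
  have hfdist : ∀ v, ∀ c ∈ C, G.simple.edist (f v) v ≤ G.simple.edist c v := fun v c hc =>
    Prod.Lex.monotone_fst _ _ (hf v c hc)
  refine ⟨f, hfC, hfdist, fun c hc => ⟨?_, fun v hv hvc => ?_⟩⟩
  · have hself : G.simple.edist (f c) c = 0 := by simpa using hfdist c c hc
    simpa using SimpleGraph.edist_eq_zero_iff.1 hself
  · obtain rfl : f v = c := by simpa using hv
    have hreach : G.simple.Reachable (f v) v := by
      obtain ⟨d, hd, hdv⟩ := hC v
      exact SimpleGraph.edist_ne_top_iff_reachable.1 (ne_top_of_le_ne_top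
        (SimpleGraph.edist_ne_top_iff_reachable.2 hdv) (hfdist v d hd))
    obtain ⟨u, huv, hu⟩ := exists_adj_edist_eq_add_one hreach hvc
    refine ⟨u, ?_, huv, dist_eq_dist_add_one huv hu hreach⟩
    have hle : G.simple.edist (f u) v ≤ G.simple.edist (f u) u + 1 :=
      SimpleGraph.edist_triangle.trans_eq (by rw [SimpleGraph.edist_eq_one_iff_adj.2 huv])
    have heq : G.simple.edist (f u) u = G.simple.edist (f v) u :=
      le_antisymm (hfdist u _ hc) <| (ENat.add_le_add_iff_right ENat.one_ne_top).1 <|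
        hu.symm.trans_le ((hfdist v _ (hfC u)).trans hle)
    have hvu := Prod.Lex.toLex_le_toLex.1 (hf v _ (hfC u))
    have huv' := Prod.Lex.toLex_le_toLex.1 (hf u _ (hfC v))
    have hcentre : f u = f v := (Fintype.equivFin V).injective <| le_antisymm
      (huv'.resolve_left heq.not_lt).2
      (hvu.resolve_left (hle.trans_eq (by rw [heq, hu])).not_gt).2
    simp [hcentre]

theorem packing_of_forall_le_degree [DecidableEq V] (hr : 0 < r) (hne : G.support.Nonempty)
    (hdeg : ∀ v ∈ G.support, 2 * (K * (r + 2)) ≤ G.simple.degree v) : G.Packing K r := by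
  refine packing_of_dense hr K G hne (Nat.le_of_mul_le_mul_left ?_ two_pos)
  calc 2 * (K * (r + 2) * G.support.card) = G.support.card • (2 * (K * (r + 2))) := by
        rw [smul_eq_mul]; ring
    _ ≤ ∑ v ∈ G.support, G.simple.degree v := Finset.card_nsmul_le_sum _ _ _ hdeg
    _ ≤ ∑ v, G.simple.degree v := Finset.sum_le_sum_of_subset (Finset.subset_univ _)
    _ = 2 * G.simple.edgeFinset.card := G.simple.sum_degrees_eq_twice_card_edges

theorem pre_compl [DecidableEq V] (f : V → V) (A : Finset V) : pre f Aᶜ = (pre f A)ᶜ := by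
  ext
  simp

theorem NoSmallModel.mult_quot_le {f : V → V} [DecidableEq V] (hns : G.NoSmallModel (q + 1) s)
    (hnear : ∀ v, G.Near (f v) R (pre f {f v})) (hs : 2 + 2 * R * (q + 1) ≤ s) (a b : V) :
    (G.quot f).mult a b ≤ q := by
  refine Nat.le_of_not_lt fun hlt => ?_
  obtain ⟨hab, x, y, rfl, rfl, -⟩ := adj_quot.1 (q.zero_le.trans_lt hlt)
  have hdisj : Disjoint {f x} {f y} := Finset.disjoint_singleton.2 hab
  rw [← edges_singleton, edges_quot hdisj] at hlt
  exact hlt.not_ge (Nat.le_of_lt_succ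
    (hns.edges_lt (hnear x) (hnear y) (disjoint_pre hdisj) (by linarith)))

theorem StarShaped.card_pre_le_degree_quot {f : V → V} {c : V} [DecidableEq V] (hq : 0 < q)
    (h : G.StarShaped c (pre f {c})) (hns : G.NoSmallModel (q + 1) s)
    (hR : ∀ v ∈ pre f {c}, G.simple.dist c v ≤ R) (hs : 2 + R * (q + 1) ≤ s)
    (hdeg : ∀ v ∈ pre f {c}, q * (q + 3) ≤ G.deg v) (hmult : ∀ a b, (G.quot f).mult a b ≤ q) :
    (pre f {c}).card ≤ (G.quot f).simple.degree c := by
  refine Nat.le_of_mul_le_mul_right ?_ hq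
  calc (pre f {c}).card * q ≤ G.edges (pre f {c}) (pre f {c})ᶜ :=
        h.card_mul_le_edges_compl hns hR hs hdeg
    _ = (G.quot f).edges {c} {c}ᶜ := by rw [← pre_compl, edges_quot disjoint_compl_right]
    _ ≤ (G.quot f).edges {c} Finset.univ := edges_mono le_rfl (Finset.subset_univ _)
    _ ≤ (G.quot f).simple.degree c * q := by
      rw [← SimpleGraph.card_neighborFinset_eq_degree, SimpleGraph.neighborFinset_eq_filter]
      exact edges_le_card_mul hmult c Finset.univ

theorem packing_of_deg [DecidableEq V] (hq : 0 < q) (hρ : 2 * (K * (q + 3)) ≤ 2 ^ ρ)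
    (hns : G.NoSmallModel (q + 1) (2 + 4 * ρ * (q + 1))) (hne : G.support.Nonempty)
    (hdeg : ∀ v ∈ G.support, q * (q + 3) ≤ G.deg v) : G.Packing K (q + 1) := by
  obtain ⟨C, hCdisj, hCcover⟩ := exists_centres G ρ
  obtain ⟨f, hfC, hfdist, hcell⟩ := exists_starShaped_cells fun v =>
    (hCcover v).imp fun c hc => ⟨hc.1, reachable_of_edist_le hc.2⟩
  have hR : ∀ c, ∀ v ∈ pre f {c}, G.simple.dist c v ≤ 2 * ρ := fun c v hv => by
    obtain rfl : f v = c := by simpa using hv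
    obtain ⟨c, hc, hcv⟩ := hCcover v
    exact dist_le_of_edist_le ((hfdist v c hc).trans hcv)
  have hnear : ∀ c ∈ C, G.Near c (2 * ρ) (pre f {c}) := fun c hc => (hcell c hc).near (hR c)
  have hlarge : ∀ c ∈ C, c ∈ G.support → 2 ^ ρ ≤ (pre f {c}).card := fun c hc hcs => by
    refine (two_pow_le_card_ball hq hns hdeg hcs ?_).trans (Finset.card_le_card fun v hv => ?_)
    · gcongr; lia
    · rw [mem_pre, Finset.mem_singleton]
      by_contra hne
      exact Finset.disjoint_left.1 (hCdisj (hfC v) hc hne)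
        (mem_ball.2 ((hfdist v c hc).trans (mem_ball.1 hv))) hv
  have hdegree : ∀ c ∈ C, c ∈ G.support → 2 ^ ρ ≤ (G.quot f).simple.degree c := fun c hc hcs =>
    (hlarge c hc hcs).trans <| (hcell c hc).card_pre_le_degree_quot hq hns (hR c)
      (by gcongr; lia) (fun v hv => hdeg v ((hcell c hc).subset_support hcs hv))
      (hns.mult_quot_le (fun v => hnear _ (hfC v)) (by linarith))
  have hcentre : ∀ v ∈ G.support, f v ∈ G.support := fun v hv => by
    obtain ⟨w, hvw⟩ := mem_support.1 hv
    exact mem_support.2 ((hnear _ (hfC v)).conn.exists_adj_of_mem (by simp) hvw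
      (hnear _ (hfC v)).mem)
  have hsupp : ∀ a ∈ (G.quot f).support, a ∈ C ∧ a ∈ G.support := fun a ha => by
    obtain ⟨b, hab⟩ := mem_support.1 ha
    obtain ⟨-, x, y, rfl, -, hxy⟩ := adj_quot.1 hab
    exact ⟨hfC x, hcentre x (left_mem_support hxy)⟩
  refine .of_quot q.succ_pos (packing_of_forall_le_degree q.succ_pos ?_ fun a ha =>
    hρ.trans (hdegree a (hsupp a ha).1 (hsupp a ha).2)) fun a ha => (hnear a (hsupp a ha).1).conn
  obtain ⟨v, hv⟩ := hne
  obtain ⟨b, hb⟩ := (SimpleGraph.degree_pos_iff_exists_adj _ (f v)).1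
    ((Nat.two_pow_pos ρ).trans_le (hdegree (f v) (hfC v) (hcentre v hv)))
  exact ⟨f v, left_mem_support hb⟩

end Cells

section Stars

variable {V : Type*} {G : Multigraph V} {h : V → V}
  {P Q S : Finset V} {a b x : V} {d q r s K ρ : ℕ}

/-- The fibres of `h` are stars, each mapped to its centre, and there are no edges between leaves.
Identifying vertices along `h` removes all vertices of small degree at once. -/
structure IsStarMap (G : Multigraph V) (h : V → V) : Prop where
  adj : ∀ x, h x ≠ x → G.simple.Adj (h x) x
  fixed : ∀ x y, G.simple.Adj x y → h x = x ∨ h y = y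

theorem IsStarMap.apply_apply (hh : G.IsStarMap h) (x : V) : h (h x) = h x := by
  by_cases hx : h x = x
  · rw [hx, hx]
  · exact (hh.fixed _ _ (hh.adj x hx)).resolve_right hx

theorem IsStarMap.card_leaves_add_card_leaves_le [DecidableEq V] {T : Finset (V × V)}
    (hh : G.IsStarMap h) (hT : ∀ p ∈ T, G.simple.Adj p.1 p.2) :
    {p ∈ T | h p.1 ≠ p.1}.card + {p ∈ T | h p.2 ≠ p.2}.card ≤ T.card := by
  rw [← Finset.card_filter_add_card_filter_not (s := T) (p := fun p => h p.1 ≠ p.1)]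
  gcongr with p hp
  exact (hh.fixed _ _ (hT p hp)).resolve_left

theorem IsStarMap.conn_union [DecidableEq V] (hh : G.IsStarMap h) (hQ : G.Conn Q)
    (hS : ∀ x ∈ S, h x ∈ Q) : G.Conn (Q ∪ S) :=
  hQ.union_of_forall_adj fun x hxS hxQ =>
    ⟨h x, hS x hxS, hh.adj x fun hx => hxQ (hx ▸ hS x hxS)⟩

variable [Fintype V]

theorem exists_isStarMap (hlow : ∀ x y, G.simple.Adj x y → d ≤ G.deg x ∨ d ≤ G.deg y) :
    ∃ h, G.IsStarMap h ∧ ∀ x ∈ G.support, d ≤ G.deg (h x) := by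
  have hcentre : ∀ x, ∃ a, (d ≤ G.deg x → a = x) ∧ (a ≠ x → G.simple.Adj a x) ∧
      (x ∈ G.support → d ≤ G.deg a) := fun x => by
    by_cases hx : d ≤ G.deg x ∨ x ∉ G.support
    · exact ⟨x, fun _ => rfl, fun hne => (hne rfl).elim,
        fun hxs => hx.resolve_right (not_not_intro hxs)⟩
    · push Not at hx
      obtain ⟨y, hxy⟩ := mem_support.1 hx.2
      exact ⟨y, fun hd => (hx.1.not_ge hd).elim, fun _ => hxy.symm,
        fun _ => (hlow x y hxy).resolve_left hx.1.not_ge⟩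
  choose h hfixed hadj hdeg using hcentre
  exact ⟨h, ⟨hadj, fun x y hxy => (hlow x y hxy).imp (hfixed x) (hfixed y)⟩, hdeg⟩

variable [DecidableEq V]

theorem IsStarMap.apply_eq_of_mem_support_quot (hh : G.IsStarMap h)
    (ha : a ∈ (G.quot h).support) : h a = a := by
  obtain ⟨b, hab⟩ := mem_support.1 ha
  obtain ⟨-, x, -, rfl, -⟩ := adj_quot.1 hab
  exact hh.apply_apply x

theorem IsStarMap.conn_pre_singleton (hh : G.IsStarMap h) (ha : h a = a) :
    G.Conn (pre h {a}) := by
  have hpre : {a} ∪ pre h {a} = pre h {a} := Finset.union_eq_right.2 (by simp [ha])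
  exact hpre ▸ hh.conn_union (conn_singleton a) fun x hx => mem_pre.1 hx

theorem IsStarMap.exists_conn_of_adj_quot (hh : G.IsStarMap h) (hab : (G.quot h).simple.Adj a b) :
    ∃ z, h z ∈ ({a, b} : Finset V) ∧ G.Conn {a, b, z} := by
  obtain ⟨-, x, y, rfl, rfl, hxy⟩ := adj_quot.1 hab
  have hconn : ∀ x y, G.simple.Adj x y → h x = x → G.Conn {h x, h y, y} := fun x y hxy hx => by
    have hunion : ({h x, h y, y} : Finset V) = {y} ∪ {x, h y} := by rw [hx]; grind
    rw [hunion]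
    refine (conn_singleton y).union_of_forall_adj fun w hw hwy => ⟨y, by simp, ?_⟩
    obtain rfl | rfl : w = x ∨ w = h y := by simpa using hw
    · exact hxy.symm
    · exact (hh.adj y fun hy => hwy (by simp [hy])).symm
  obtain hx | hy := hh.fixed x y hxy
  · exact ⟨y, by simp, hconn x y hxy hx⟩
  · exact ⟨x, by simp, Finset.insert_comm (h x) (h y) {x} ▸ hconn y x hxy.symm hy⟩

theorem IsStarMap.exists_conn_of_quot (hh : G.IsStarMap h) (hP : (G.quot h).Conn P)
    (hfix : ∀ x ∈ P, h x = x) :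
    ∃ Q, P ⊆ Q ∧ Q ⊆ pre h P ∧ G.Conn Q ∧ Q.card + 1 ≤ 2 * P.card := by
  obtain ⟨c, hc⟩ := hP.nonempty
  refine hP.induction_on (motive := fun A => ∃ Q, A ⊆ Q ∧ Q ⊆ pre h A ∧ G.Conn Q ∧
    Q.card + 1 ≤ 2 * A.card) hc ?_ ?_
  · exact ⟨{c}, le_rfl, by simp [hfix c hc], conn_singleton c, by simp⟩
  · rintro A x hx y hy hxy ⟨Q, hAQ, hQA, hQ, hQcard⟩
    by_cases hyA : y ∈ A
    · rw [Finset.insert_eq_of_mem hyA]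
      exact ⟨Q, hAQ, hQA, hQ, hQcard⟩
    obtain ⟨z, hz, hconn⟩ := hh.exists_conn_of_adj_quot hxy
    have hunion : Q ∪ {x, y, z} = Q ∪ {y, z} := by grind
    refine ⟨Q ∪ {y, z}, by grind, ?_, hunion ▸ hQ.union hconn (hAQ hx) (by simp), ?_⟩
    · have hy' := hfix y hy
      intro w hw
      have hwQ := @hQA w
      simp only [mem_pre] at hwQ ⊢
      grind
    · have hcard := Finset.card_union_le Q {y, z}
      have htwo := Finset.card_le_two (a := y) (b := z)
      rw [Finset.card_insert_of_notMem hyA]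
      lia

theorem IsStarMap.exists_isModel_of_quot (hh : G.IsStarMap h) (hr : 0 < r)
    (hPQ : (G.quot h).IsModel r P Q) :
    ∃ P' Q', G.IsModel r P' Q' ∧ P'.card + Q'.card ≤ 2 * (P.card + Q.card) + r := by
  have hfix : ∀ x ∈ P ∪ Q, h x = x := fun x hx =>
    hh.apply_eq_of_mem_support_quot (hPQ.union_subset_support hr hx)
  obtain ⟨P₁, hPP₁, hP₁P, hP₁, hP₁card⟩ := hh.exists_conn_of_quot hPQ.conn_left
    fun x hx => hfix x (Finset.mem_union_left Q hx)
  obtain ⟨Q₁, hQQ₁, hQ₁Q, hQ₁, hQ₁card⟩ := hh.exists_conn_of_quot hPQ.conn_right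
    fun x hx => hfix x (Finset.mem_union_right P hx)
  obtain ⟨T, hT, hTcard, hTadj, hTr⟩ := exists_adj_pairs_of_le_edges
    (hPQ.le_edges.trans_eq (edges_quot hPQ.disjoint))
  have hTP : ∀ p ∈ T, h p.1 ∈ P := fun p hp => mem_pre.1 (Finset.mem_product.1 (hT hp)).1
  have hTQ : ∀ p ∈ T, h p.2 ∈ Q := fun p hp => mem_pre.1 (Finset.mem_product.1 (hT hp)).2
  let SP := {p ∈ T | h p.1 ≠ p.1}.image Prod.fst
  let SQ := {p ∈ T | h p.2 ≠ p.2}.image Prod.snd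
  have hcard : SP.card + SQ.card ≤ r :=
    (add_le_add Finset.card_image_le Finset.card_image_le).trans
      ((hh.card_leaves_add_card_leaves_le hTadj).trans hTcard)
  have hSP : ∀ x ∈ SP, h x ∈ P := by
    simp only [SP, Finset.forall_mem_image, Finset.mem_filter]
    exact fun p hp => hTP p hp.1
  have hSQ : ∀ x ∈ SQ, h x ∈ Q := by
    simp only [SQ, Finset.forall_mem_image, Finset.mem_filter]
    exact fun p hp => hTQ p hp.1
  have hdisj : Disjoint (P₁ ∪ SP) (Q₁ ∪ SQ) := Finset.disjoint_of_subset_left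
    (Finset.union_subset hP₁P fun x hx => mem_pre.2 (hSP x hx)) <| Finset.disjoint_of_subset_right
    (Finset.union_subset hQ₁Q fun x hx => mem_pre.2 (hSQ x hx)) (disjoint_pre hPQ.disjoint)
  have hTsub : T ⊆ (P₁ ∪ SP) ×ˢ (Q₁ ∪ SQ) := fun p hp => by
    refine Finset.mem_product.2 ⟨?_, ?_⟩
    · by_cases hfst : h p.1 = p.1
      · exact Finset.mem_union_left _ (hPP₁ (hfst ▸ hTP p hp))
      · exact Finset.mem_union_right _ (Finset.mem_image_of_mem _ (by simp [hp, hfst]))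
    · by_cases hsnd : h p.2 = p.2
      · exact Finset.mem_union_left _ (hQQ₁ (hsnd ▸ hTQ p hp))
      · exact Finset.mem_union_right _ (Finset.mem_image_of_mem _ (by simp [hp, hsnd]))
  refine ⟨P₁ ∪ SP, Q₁ ∪ SQ, ⟨hh.conn_union hP₁ fun x hx => hPP₁ (hSP x hx),
    hh.conn_union hQ₁ fun x hx => hQQ₁ (hSQ x hx), hdisj, ?_⟩, ?_⟩
  · rw [edges_eq_sum_product]
    exact hTr.trans (Finset.sum_le_sum_of_subset hTsub)
  · have hPunion := Finset.card_union_le P₁ SP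
    have hQunion := Finset.card_union_le Q₁ SQ
    lia

theorem NoSmallModel.quot (hns : G.NoSmallModel r (2 * s + r)) (hh : G.IsStarMap h) (hr : 0 < r) :
    (G.quot h).NoSmallModel r s := by
  intro P Q hPQ
  obtain ⟨P', Q', hPQ', hcard⟩ := hh.exists_isModel_of_quot hr hPQ
  have hlarge := hns P' Q' hPQ'
  lia

theorem deg_quot (h : V → V) (a : V) :
    (G.quot h).deg a = G.edges (pre h {a}) (pre h {a})ᶜ := by
  rw [← pre_compl, ← edges_quot disjoint_compl_right, edges, Finset.sum_singleton, deg,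
    ← Finset.sum_add_sum_compl {a}, Finset.sum_singleton, mult_self, zero_add]

theorem IsStarMap.deg_le_mul_deg_quot (hh : G.IsStarMap h) (hq : 0 < q)
    (hm : ∀ x y, G.mult x y ≤ q) (htwo : ∀ u v, G.simple.Adj u v → ∃ z ≠ u, G.simple.Adj v z)
    (ha : h a = a) : G.deg a ≤ q * (G.quot h).deg a := by
  have haa : a ∈ pre h {a} := by simp [ha]
  rw [deg_quot, edges, Finset.mul_sum, ← Finset.add_sum_erase _ _ haa, deg,
    ← Finset.sum_add_sum_compl (pre h {a}), add_comm]
  refine add_le_add (Nat.le_mul_of_pos_left _ hq) ?_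
  rw [← Finset.add_sum_erase _ _ haa, G.mult_self, zero_add]
  refine Finset.sum_le_sum fun y hy => ?_
  obtain hay | hay := (G.mult a y).eq_zero_or_pos
  · exact hay ▸ Nat.zero_le _
  obtain ⟨hya, hy⟩ : y ≠ a ∧ h y = a := by simpa using hy
  obtain ⟨z, hza, hyz⟩ := htwo a y hay
  have hz : h z = z := (hh.fixed y z hyz).resolve_left fun hy' => hya (hy'.symm.trans hy)
  have hmem : z ∈ (pre h {a})ᶜ := by simpa [hz] using hza
  exact (hm a y).trans (Nat.le_mul_of_pos_right _ (hyz.trans_le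
    (Finset.single_le_sum (f := G.mult y) (fun _ _ => Nat.zero_le _) hmem)))

end Stars

section Irreducible

variable {V : Type*} [Fintype V] [DecidableEq V] {G : Multigraph V} {q K ρ : ℕ}

/-- The degree above which a vertex becomes the centre of a star. After identifying the stars, the
centres still have degree at least `q * (q + 3)`. -/
def highDeg (q : ℕ) : ℕ := q * (q * (q + 3))

theorem edges_pair_compl_le (G : Multigraph V) (u v : V) :
    G.edges {u, v} {u, v}ᶜ ≤ G.deg u + G.deg v := calc
  _ ≤ G.edges {u, v} Finset.univ := edges_mono le_rfl (Finset.subset_univ _)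
  _ ≤ G.deg u + G.deg v := by
    obtain rfl | huv := eq_or_ne u v
    · simp [edges, deg]
    · rw [edges, Finset.sum_pair huv, deg, deg]

theorem packing_of_irreducible (hq : 0 < q) (hρ : 2 * (K * (q + 3)) ≤ 2 ^ ρ)
    (hns : G.NoSmallModel (q + 1) (2 * (2 + 4 * ρ * (q + 1)) + (q + 1)))
    (hne : G.support.Nonempty)
    (hout : ∀ u v, G.simple.Adj u v → 2 * highDeg q < G.edges {u, v} {u, v}ᶜ)
    (htwo : ∀ u v, G.simple.Adj u v → ∃ z ≠ u, G.simple.Adj v z) : G.Packing K (q + 1) := by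
  have hlow : ∀ x y, G.simple.Adj x y → highDeg q ≤ G.deg x ∨ highDeg q ≤ G.deg y :=
    fun x y hxy => by
      have hlarge := (hout x y hxy).trans_le (edges_pair_compl_le G x y)
      lia
  obtain ⟨h, hh, hdeg⟩ := exists_isStarMap hlow
  have hmult : ∀ x y, G.mult x y ≤ q := hns.mult_le (by lia)
  have hquot : ∀ x ∈ G.support, q * (q + 3) ≤ (G.quot h).deg (h x) := fun x hx =>
    Nat.le_of_mul_le_mul_left ((hdeg x hx).trans
      (hh.deg_le_mul_deg_quot hq hmult htwo (hh.apply_apply x))) hq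
  have hsupp : ∀ a ∈ (G.quot h).support, ∃ x ∈ G.support, h x = a := fun a ha => by
    obtain ⟨b, hab⟩ := mem_support.1 ha
    obtain ⟨-, x, y, hx, -, hxy⟩ := adj_quot.1 hab
    exact ⟨x, left_mem_support hxy, hx⟩
  refine .of_quot q.succ_pos (packing_of_deg hq hρ (hns.quot hh q.succ_pos) ?_ fun a ha => ?_)
    fun a ha => hh.conn_pre_singleton (hh.apply_eq_of_mem_support_quot ha)
  · obtain ⟨x, hx⟩ := hne
    exact ⟨h x, deg_pos_iff.1 ((Nat.mul_pos hq (by lia)).trans_le (hquot x hx))⟩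
  · obtain ⟨x, hx, rfl⟩ := hsupp a ha
    exact hquot x hx

theorem Tangled.packing (hq : 0 < q) (hρ : 2 * (K * (q + 3)) ≤ 2 ^ ρ) (j : ℕ) (hj : j ≤ K)
    (G : Multigraph V) (p : V → ℕ) {m : ℕ}
    (hm : j * (2 * highDeg q * (2 * (2 + 4 * ρ * (q + 1)) + (q + 1))) + 2 * (2 * highDeg q) < m)
    (hT : G.Tangled p (2 * highDeg q) m) : G.Packing j (q + 1) := by
  induction j generalizing G p m with
  | zero => exact packing_zero _
  | succ j ihj =>
    induction hN : G.support.card using Nat.strong_induction_on generalizing G p with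
    | _ N ih =>
      subst hN
      have hsmaller : ∀ {u v : V}, G.simple.Adj u v → ∀ p' : V → ℕ,
          (G.contract u v).Tangled p' (2 * highDeg q) m → G.Packing (j + 1) (q + 1) :=
        fun {u v} huv p' hT' => .of_contract q.succ_pos huv <| ih _
          ((Finset.card_le_card (support_contract_subset huv)).trans_lt
            (Finset.card_erase_lt_of_mem (right_mem_support huv))) _ p' hT' rfl
      by_cases hns : G.NoSmallModel (q + 1) (2 * (2 + 4 * ρ * (q + 1)) + (q + 1))
      · by_cases hout : ∃ u v, G.simple.Adj u v ∧ G.edges {u, v} {u, v}ᶜ ≤ 2 * highDeg q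
        · obtain ⟨u, v, huv, he⟩ := hout
          exact hsmaller huv _ (hT.contract_of_edges_le huv.ne (by lia) he)
        by_cases htwo : ∃ u v, G.simple.Adj u v ∧ ∀ z, G.simple.Adj v z → z = u
        · obtain ⟨u, v, huv, hz⟩ := htwo
          exact hsmaller huv _ (hT.contract_of_forall_adj (by lia) hz)
        push Not at hout htwo
        refine (packing_of_irreducible hq hρ hns (hT.support_nonempty (by lia)) hout
          fun u v huv => ?_).mono hj le_rfl
        exact (htwo u v huv).imp fun z hz => hz.symm
      · simp only [NoSmallModel, not_forall, not_lt] at hns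
        obtain ⟨P, Q, hPQ, hcard⟩ := hns
        have hM := Nat.mul_le_mul_left (2 * highDeg q) ((Finset.card_union_le P Q).trans hcard)
        rw [add_mul, one_mul] at hm
        exact .succ_of_del q.succ_pos hPQ (ihj (by lia) _ p
          (m := m - 2 * highDeg q * (P ∪ Q).card) (by lia) (hT.del (by lia)))

end Irreducible

section Separators

variable {V : Type*} {G : Multigraph V} {C D U X Y W B : Finset V} {u x y : V}
  {N k m t i : ℕ} {bag : ℕ → Finset V} {par : ℕ → ℕ}

/-- The graph on `Fin N` in which every `i > 0` is joined to `par i`; the index tree of the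
tree-decompositions built here. -/
def parentGraph (N : ℕ) (par : ℕ → ℕ) : SimpleGraph (Fin N) where
  Adj i j := (j < i ∧ par i = j) ∨ (i < j ∧ par j = i)
  symm := ⟨fun _ _ h => h.symm⟩
  loopless := ⟨fun i h => by simp at h⟩

theorem parentGraph_induce_connected {S : Set (Fin N)} {r : Fin N} (hr : r ∈ S)
    (hS : ∀ t ∈ S, t ≠ r → ∃ s ∈ S, s < t ∧ par t = s) :
    ((parentGraph N par).induce S).Connected := by
  refine (SimpleGraph.connected_iff_exists_forall_reachable _).2 ⟨⟨r, hr⟩, fun ⟨t, ht⟩ => ?_⟩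
  induction t using WellFoundedLT.induction with
  | _ t ih =>
    obtain rfl | htr := eq_or_ne t r
    · exact .refl _
    · obtain ⟨s, hs, hst, hpar⟩ := hS t ht htr
      exact (ih s hst hs).trans (SimpleGraph.Adj.reachable (Or.inr ⟨hst, hpar⟩))

theorem parentGraph_connected (hN : 0 < N) (hpar : ∀ i, 0 < i → i < N → par i < i) :
    (parentGraph N par).Connected := by
  refine (SimpleGraph.induceUnivIso _).connected_iff.1
    (parentGraph_induce_connected (r := ⟨0, hN⟩) (Set.mem_univ _) fun t _ ht => ?_)
  have hlt := hpar t (Nat.pos_of_ne_zero fun h => ht (Fin.ext h)) t.2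
  exact ⟨⟨par t, hlt.trans t.2⟩, Set.mem_univ _, hlt, rfl⟩

theorem parentGraph_isTree (hN : 0 < N) (hpar : ∀ i, 0 < i → i < N → par i < i) :
    (parentGraph N par).IsTree := by
  have hconn := parentGraph_connected hN hpar
  let e : Fin N → Sym2 (Fin N) := fun i => s(i, if h : par i < N then ⟨par i, h⟩ else i)
  have hmem : ∀ i j : Fin N, j < i → par i = j → s(i, j) ∈ e '' {⟨0, hN⟩}ᶜ := by
    refine fun i j hji hp => ⟨i, ?_, by simp [e, hp]⟩
    rintro rfl
    exact absurd (Fin.lt_def.1 hji) (Nat.not_lt_zero _)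
  have hsub : (parentGraph N par).edgeSet ⊆ e '' {⟨0, hN⟩}ᶜ := by
    intro s hs
    induction s with
    | _ i j =>
      obtain ⟨hji, hp⟩ | ⟨hij, hp⟩ := (SimpleGraph.mem_edgeSet _).1 hs
      · exact hmem i j hji hp
      · exact Sym2.eq_swap ▸ hmem j i hij hp
  have hcard : (parentGraph N par).edgeSet.ncard ≤ ({⟨0, hN⟩}ᶜ : Set (Fin N)).ncard :=
    (Set.ncard_le_ncard hsub (Set.toFinite _)).trans (Set.ncard_image_le (Set.toFinite _))
  have hcompl := Set.ncard_add_ncard_compl ({⟨0, hN⟩} : Set (Fin N))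
  rw [Set.ncard_singleton] at hcompl
  refine SimpleGraph.isTree_iff_connected_and_card.2
    ⟨hconn, le_antisymm ?_ hconn.card_vert_le_card_edgeSet_add_one⟩
  rw [Nat.card_coe_set_eq]
  lia

/-- `D` is a connected component of the subgraph induced by `U`. -/
structure IsComponent (G : Multigraph V) (U D : Finset V) : Prop where
  subset : D ⊆ U
  conn : G.Conn D
  mem_of_adj : ∀ x ∈ D, ∀ y ∈ U, G.simple.Adj x y → y ∈ D

theorem exists_isComponent (hu : u ∈ U) : ∃ D, G.IsComponent U D ∧ u ∈ D := by
  classical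
  obtain ⟨D, hD, hmax⟩ := ({D ∈ U.powerset | u ∈ D ∧ G.Conn D}).exists_max_image Finset.card
    ⟨{u}, by simp [hu, conn_singleton]⟩
  obtain ⟨hDU, huD, hDc⟩ := by simpa only [Finset.mem_filter, Finset.mem_powerset] using hD
  refine ⟨D, ⟨hDU, hDc, fun x hx y hy hxy => ?_⟩, huD⟩
  by_contra hyD
  have hle := hmax (insert y D) (Finset.mem_filter.2 ⟨Finset.mem_powerset.2
    (Finset.insert_subset hy hDU), Finset.mem_insert_of_mem huD, hDc.insert hx hxy⟩)
  rw [Finset.card_insert_of_notMem hyD] at hle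
  lia

theorem IsComponent.subset_of_conn (hD : G.IsComponent U D) (hC : G.Conn C) (hCU : C ⊆ U)
    (hx : x ∈ C) (hxD : x ∈ D) : C ⊆ D := by
  classical
  by_contra hCD
  obtain ⟨a, ha, b, hb, hbA, hab⟩ := (conn_iff.1 hC).2 (C ∩ D) Finset.inter_subset_left
    ⟨x, Finset.mem_inter.2 ⟨hx, hxD⟩⟩ (fun h => hCD (Finset.inter_eq_left.1 h))
  exact hbA (Finset.mem_inter.2 ⟨hb, hD.mem_of_adj a (Finset.mem_inter.1 ha).2 b (hCU hb) hab⟩)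

theorem Conn.eq_of_forall_not_lt {α : Type*} [LinearOrder α] {c : V → α} (hC : G.Conn C)
    (hc : ∀ x ∈ C, ∀ y ∈ C, G.simple.Adj x y → ¬ c x < c y) (hx : x ∈ C) (hy : y ∈ C) :
    c x = c y := by
  by_contra hne
  obtain ⟨a, ha, b, hb, hbA, hab⟩ := (conn_iff.1 hC).2 {z ∈ C | c z = c y}
    (Finset.filter_subset _ _) ⟨y, Finset.mem_filter.2 ⟨hy, rfl⟩⟩
    fun h => hne (Finset.filter_eq_self.1 h x hx)
  obtain ⟨haC, hay⟩ := Finset.mem_filter.1 ha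
  exact hbA (Finset.mem_filter.2 ⟨hb, (le_antisymm (not_lt.1 (hc a haC b hb hab))
    (not_lt.1 (hc b hb a haC hab.symm))).trans hay⟩)

/-- `X` is a balanced separator of `W`: connected sets avoiding `X` contain at most half of `W`. -/
def IsBalancedSeparator [DecidableEq V] (G : Multigraph V) (X W : Finset V) : Prop :=
  ∀ C, G.Conn C → Disjoint C X → 2 * (C ∩ W).card ≤ W.card

/-- Bags `0, …, N - 1` with fewer than `k` vertices, where each new bag meets the union of the
previous ones within its parent, form a tree-decomposition of the subgraph induced by the complement
of `U`. -/
structure IsBagSequence [DecidableEq V] (G : Multigraph V) (N : ℕ) (bag : ℕ → Finset V)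
    (par : ℕ → ℕ) (k : ℕ) (U : Finset V) : Prop where
  pos : 0 < N
  par_lt : ∀ i, 0 < i → i < N → par i < i
  inter_subset : ∀ i < N, ∀ j < i, bag i ∩ bag j ⊆ bag (par i)
  card_lt : ∀ i < N, (bag i).card < k
  notMem_iff : ∀ x, x ∉ U ↔ ∃ i < N, x ∈ bag i
  exists_of_adj : ∀ x y, G.simple.Adj x y → x ∉ U → y ∉ U → ∃ i < N, x ∈ bag i ∧ y ∈ bag i

variable [DecidableEq V]

theorem IsBagSequence.append (h : G.IsBagSequence N bag par k U) (hi : i < N) (hB : B.card < k)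
    (hBi : ∀ x ∈ B, x ∉ U → x ∈ bag i)
    (hBU : ∀ x ∈ B, x ∈ U → ∀ y ∉ U, G.simple.Adj x y → y ∈ B) :
    G.IsBagSequence (N + 1) (Function.update bag N B) (Function.update par N i) k (U \ B) := by
  have hbag : ∀ j < N, Function.update bag N B j = bag j :=
    fun j hj => Function.update_of_ne hj.ne _ _
  have hpar : ∀ j < N, Function.update par N i j = par j :=
    fun j hj => Function.update_of_ne hj.ne _ _
  have hpar_lt : ∀ j < N, ∀ l < j, par j < N :=
    fun j hj l hl => (h.par_lt j (Nat.zero_lt_of_lt hl) hj).trans hj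
  refine ⟨N.succ_pos, fun j hj hjN => ?_, fun j hjN l hl => ?_, fun j hjN => ?_, fun x => ?_,
    fun x y hxy hx hy => ?_⟩
  · obtain hjN | rfl := Nat.lt_succ_iff_lt_or_eq.1 hjN
    · exact hpar j hjN ▸ h.par_lt j hj hjN
    · rwa [Function.update_self]
  · obtain hjN | rfl := Nat.lt_succ_iff_lt_or_eq.1 hjN
    · rw [hbag j hjN, hbag l (hl.trans hjN), hpar j hjN, hbag _ (hpar_lt j hjN l hl)]
      exact h.inter_subset j hjN l hl
    · rw [Function.update_self, Function.update_self, hbag l hl, hbag i hi]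
      intro x hx
      obtain ⟨hxB, hxl⟩ := Finset.mem_inter.1 hx
      exact hBi x hxB ((h.notMem_iff x).2 ⟨l, hl, hxl⟩)
  · obtain hjN | rfl := Nat.lt_succ_iff_lt_or_eq.1 hjN
    · exact hbag j hjN ▸ h.card_lt j hjN
    · rwa [Function.update_self]
  · rw [Finset.mem_sdiff, not_and_or, not_not, h.notMem_iff, Nat.exists_lt_succ_right,
      Function.update_self]
    grind
  · rw [Finset.mem_sdiff, not_and_or, not_not] at hx hy
    rw [Nat.exists_lt_succ_right, Function.update_self]
    by_cases hxy' : x ∉ U ∧ y ∉ U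
    · obtain ⟨j, hj, hxj, hyj⟩ := h.exists_of_adj x y hxy hxy'.1 hxy'.2
      exact .inl ⟨j, hj, by rwa [hbag j hj], by rwa [hbag j hj]⟩
    · have hyx := hxy.symm
      exact .inr (by grind)

theorem IsComponent.of_sdiff (hD : G.IsComponent (U \ B) D) (hDB : ∀ x ∈ D, ∀ y ∈ B, y ∈ U →
    ¬ G.simple.Adj x y) : G.IsComponent U D where
  subset := hD.subset.trans Finset.sdiff_subset
  conn := hD.conn
  mem_of_adj x hx y hy hxy :=
    hD.mem_of_adj x hx y (Finset.mem_sdiff.2 ⟨hy, fun hyB => hDB x hx y hyB hy hxy⟩) hxy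

theorem IsBagSequence.parentGraph_induce_connected (h : G.IsBagSequence N bag par k U)
    (hx : x ∉ U) : ((parentGraph N par).induce {t : Fin N | x ∈ bag t}).Connected := by
  have hex := (h.notMem_iff x).1 hx
  obtain ⟨hfirst, hxfirst⟩ := Nat.find_spec hex
  refine Multigraph.parentGraph_induce_connected (r := ⟨Nat.find hex, hfirst⟩) hxfirst
    fun t ht htr => ?_
  have hlt : Nat.find hex < t :=
    (Nat.find_min' hex ⟨t.2, ht⟩).lt_of_ne fun heq => htr (Fin.ext heq.symm)
  have hpar := h.par_lt t (Nat.zero_lt_of_lt hlt) t.2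
  exact ⟨⟨par t, hpar.trans t.2⟩,
    h.inter_subset t t.2 _ hlt (Finset.mem_inter.2 ⟨ht, hxfirst⟩), hpar, rfl⟩

/-- The neighbourhood of a vertex set. -/
def nbhd [Fintype V] (G : Multigraph V) (D : Finset V) : Finset V :=
  {y | y ∉ D ∧ ∃ x ∈ D, G.simple.Adj x y}

section Nbhd

variable [Fintype V]

theorem mem_nbhd : y ∈ G.nbhd D ↔ y ∉ D ∧ ∃ x ∈ D, G.simple.Adj x y := Finset.mem_filter_univ y

theorem IsComponent.disjoint_nbhd (hD : G.IsComponent U D) : Disjoint (G.nbhd D) U := by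
  refine Finset.disjoint_left.2 fun y hy hyU => ?_
  obtain ⟨hyD, x, hx, hxy⟩ := mem_nbhd.1 hy
  exact hyD (hD.mem_of_adj x hx y hyU hxy)

theorem IsBalancedSeparator.two_mul_card_nbhd_le (hX : G.IsBalancedSeparator X W) (hD : G.Conn D)
    (hDX : Disjoint D X) (hN : G.nbhd D ⊆ W ∪ X) :
    2 * (G.nbhd D).card ≤ W.card + 2 * X.card := by
  have hconn : G.Conn (D ∪ (G.nbhd D \ X)) :=
    hD.union_of_forall_adj fun y hy _ => (mem_nbhd.1 (Finset.mem_sdiff.1 hy).1).2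
  have hhalf := hX _ hconn (Finset.disjoint_union_left.2 ⟨hDX, Finset.sdiff_disjoint⟩)
  have hsub : G.nbhd D ⊆ ((D ∪ (G.nbhd D \ X)) ∩ W) ∪ X := by
    intro y hy
    have hyWX := Finset.mem_union.1 (hN hy)
    by_cases hyX : y ∈ X <;> grind
  have hcard := (Finset.card_le_card hsub).trans (Finset.card_union_le _ _)
  lia

theorem IsComponent.nbhd_subset_of_sdiff (hC : G.IsComponent (U \ B) C) (hD : G.IsComponent U D)
    (hCD : C ⊆ D) (hB : G.nbhd D ⊆ B) : G.nbhd C ⊆ B := by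
  intro y hy
  obtain ⟨hyC, x, hx, hxy⟩ := mem_nbhd.1 hy
  by_cases hyD : y ∈ D
  · by_contra hyB
    exact hyC (hC.mem_of_adj x hx y (Finset.mem_sdiff.2 ⟨hD.subset hyD, hyB⟩) hxy)
  · exact hB (mem_nbhd.2 ⟨hyD, x, hCD hx, hxy⟩)

/-- The invariant under which bags are added: the neighbourhood of every component of what is left
has fewer than `k` vertices and lies in one of the bags `0, …, N - 1`. -/
def IsAttached (G : Multigraph V) (N : ℕ) (bag : ℕ → Finset V) (k : ℕ) (U : Finset V) : Prop :=
  ∀ D, G.IsComponent U D → ∃ i < N, G.nbhd D ⊆ bag i ∧ (G.nbhd D).card < k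

theorem IsBagSequence.exists_append (hseq : G.IsBagSequence N bag par (3 * m) U)
    (hU : G.IsAttached N bag (2 * m) U)
    (hsep : ∀ W : Finset V, W.card ≤ 2 * m → ∃ X : Finset V, X.card < m ∧
      G.IsBalancedSeparator X W) (hu : u ∈ U) :
    ∃ B bag' par', u ∈ B ∧ G.IsBagSequence (N + 1) bag' par' (3 * m) (U \ B) ∧
      G.IsAttached (N + 1) bag' (2 * m) (U \ B) := by
  obtain ⟨D, hD, huD⟩ := exists_isComponent hu
  obtain ⟨i, hi, hDi, hDm⟩ := hU D hD
  have hDU : ∀ y ∈ G.nbhd D, y ∉ U := fun y hy => Finset.disjoint_left.1 hD.disjoint_nbhd hy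
  have hW : (insert u (G.nbhd D)).card ≤ 2 * m := (Finset.card_insert_le _ _).trans hDm
  obtain ⟨X, hXm, hX⟩ := hsep (insert u (G.nbhd D)) hW
  let B := (insert u (G.nbhd D) ∪ X) ∩ (D ∪ G.nbhd D)
  have hnB : G.nbhd D ⊆ B := by grind
  have hBD : ∀ x ∈ B, x ∈ U → x ∈ D := by grind
  have hBm : B.card < 3 * m := by
    have hle := (Finset.card_le_card Finset.inter_subset_left).trans
      (Finset.card_union_le (insert u (G.nbhd D)) X) (a := B.card)
    lia
  refine ⟨B, Function.update bag N B, Function.update par N i, by grind,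
    hseq.append hi hBm (fun x hx hxU => ?_) fun x hx hxU y hyU hxy => ?_, fun C hC => ?_⟩
  · exact hDi (((Finset.mem_union.1 (Finset.mem_inter.1 hx).2)).resolve_left
      fun hxD => hxU (hD.subset hxD))
  · exact hnB (mem_nbhd.2 ⟨fun hyD => hyU (hD.subset hyD), x, hBD x hx hxU, hxy⟩)
  by_cases hCD : ∃ z ∈ C, z ∈ D
  · obtain ⟨z, hzC, hzD⟩ := hCD
    have hCD := hD.subset_of_conn hC.conn (hC.subset.trans Finset.sdiff_subset) hzC hzD
    have hCB := hC.nbhd_subset_of_sdiff hD hCD hnB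
    have hCX : Disjoint C X := Finset.disjoint_left.2 fun x hx hxX =>
      (Finset.mem_sdiff.1 (hC.subset hx)).2 (by grind)
    have hcard := hX.two_mul_card_nbhd_le hC.conn hCX (hCB.trans Finset.inter_subset_left)
    exact ⟨N, N.lt_succ_self, by rwa [Function.update_self], by lia⟩
  · push Not at hCD
    obtain ⟨j, hj, hCj, hCm⟩ := hU C (hC.of_sdiff fun x hx y hyB hyU hxy =>
      hCD x hx (hD.mem_of_adj y (hBD y hyB hyU) x (Finset.mem_sdiff.1 (hC.subset hx)).1 hxy.symm))
    exact ⟨j, hj.trans N.lt_succ_self, by rwa [Function.update_of_ne hj.ne], hCm⟩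

theorem IsBagSequence.exists_empty (hseq : G.IsBagSequence N bag par (3 * m) U)
    (hU : G.IsAttached N bag (2 * m) U)
    (hsep : ∀ W : Finset V, W.card ≤ 2 * m → ∃ X : Finset V, X.card < m ∧
      G.IsBalancedSeparator X W) :
    ∃ N bag par, G.IsBagSequence N bag par (3 * m) ∅ := by
  induction U using Finset.strongInduction generalizing N bag par with
  | _ U ih =>
    obtain rfl | ⟨u, hu⟩ := U.eq_empty_or_nonempty
    · exact ⟨N, bag, par, hseq⟩
    obtain ⟨B, bag', par', huB, hseq', hU'⟩ := hseq.exists_append hU hsep hu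
    exact ih (U \ B) ((Finset.ssubset_iff_of_subset Finset.sdiff_subset).2
      ⟨u, hu, fun h => (Finset.mem_sdiff.1 h).2 huB⟩) hseq' hU'

omit [Fintype V] in
theorem exists_isBagSequence [Finite V] (hm : 0 < m)
    (hsep : ∀ W : Finset V, W.card ≤ 2 * m → ∃ X : Finset V, X.card < m ∧
      G.IsBalancedSeparator X W) :
    ∃ N bag par, G.IsBagSequence N bag par (3 * m) ∅ := by
  have := Fintype.ofFinite V
  have hseq : G.IsBagSequence 1 (fun _ => ∅) (fun _ => 0) (3 * m) Finset.univ :=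
    ⟨one_pos, fun i hi hi' => by lia, by simp, by simpa using hm, by simp, by simp⟩
  refine hseq.exists_empty (fun D hD => ?_) hsep
  have hempty : G.nbhd D = ∅ := by
    simpa [← Finset.top_eq_univ] using hD.disjoint_nbhd
  exact ⟨0, one_pos, hempty.le, by rw [hempty, Finset.card_empty]; lia⟩

end Nbhd

section Tangled

variable [Fintype V] {S : Finset V} {c : V → ℕ}

theorem two_mul_card_le_cut (hY : ∀ x ∈ Y, x ∉ S ∧ ∃ y ∉ S, c x < c y ∧ G.simple.Adj x y) :
    2 * Y.card ≤ G.cut S c := by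
  let f (x y : V) : ℕ := (if x ∉ S ∧ y ∉ S ∧ c x < c y then 1 else 0) * G.mult x y
  have hf : ∀ x ∈ Y, 1 ≤ ∑ y, f x y := by
    intro x hx
    obtain ⟨hxS, y, hyS, hlt, hxy⟩ := hY x hx
    refine le_trans ?_ (Finset.single_le_sum (fun _ _ => Nat.zero_le _) (Finset.mem_univ y))
    simpa [f, hxS, hyS, hlt] using show 1 ≤ G.mult x y from hxy
  calc 2 * Y.card ≤ 2 * ∑ x, ∑ y, f x y := by
        refine Nat.mul_le_mul_left 2 ?_
        rw [Finset.card_eq_sum_ones]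
        exact (Finset.sum_le_sum hf).trans (Finset.sum_le_sum_of_subset (Finset.subset_univ Y))
    _ = ∑ x, ∑ y, (f x y + f y x) := by
        simp only [Finset.sum_add_distrib]
        rw [Finset.sum_comm (f := fun x y => f y x), two_mul]
    _ = G.cut S c := by
        refine Finset.sum_congr rfl fun x _ => Finset.sum_congr rfl fun y _ => ?_
        simp only [f, G.mult_comm y x, ← add_mul]
        congr 1
        grind

theorem tangled_of_forall_not_isBalancedSeparator (ht : 0 < t)
    (hW : ∀ X : Finset V, X.card < m → ¬ G.IsBalancedSeparator X W) :
    G.Tangled (fun x => if x ∈ W then 1 else 0) t m := by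
  intro S c hcost
  let Y : Finset V := {x | x ∉ S ∧ ∃ y ∉ S, c x < c y ∧ G.simple.Adj x y}
  have hcut : 2 * Y.card ≤ G.cut S c := two_mul_card_le_cut fun x hx => (Finset.mem_filter.1 hx).2
  have hSY : (S ∪ Y).card < m := by
    have hunion := Finset.card_union_le S Y
    have hS : S.card ≤ t * S.card := Nat.le_mul_of_pos_left _ ht
    lia
  obtain ⟨C, hC, hCSY, hCW⟩ :
      ∃ C, G.Conn C ∧ Disjoint C (S ∪ Y) ∧ W.card < 2 * (C ∩ W).card := by
    simpa [IsBalancedSeparator, and_assoc] using hW (S ∪ Y) hSY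
  obtain ⟨hCS, hCY⟩ := Finset.disjoint_union_right.1 hCSY
  rw [Finset.disjoint_left] at hCS hCY
  obtain ⟨z, hz⟩ := hC.nonempty
  have hcol : ∀ x ∈ C, c x = c z := fun x hx => hC.eq_of_forall_not_lt (fun a ha b hb hab hlt =>
    hCY ha (Finset.mem_filter.2 ⟨Finset.mem_univ a, hCS ha, b, hCS hb, hlt, hab⟩)) hx hz
  refine ⟨c z, ?_⟩
  rw [Finset.sum_ite_mem, Finset.univ_inter, ← Finset.card_eq_sum_ones, Finset.sum_ite_mem,
    ← Finset.card_eq_sum_ones]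
  refine hCW.trans_le (Nat.mul_le_mul_left 2 (Finset.card_le_card fun x hx => ?_))
  grind

end Tangled

end Separators

section OfGraph

variable {α β : Type*} {G : Graph α β} {N n k r m t : ℕ}

open scoped Classical in
/-- The multigraph underlying a graph, with loops removed. Multiplicities are capped at `N`, so that
infinitely many parallel edges are allowed. -/
noncomputable def ofGraph (G : Graph α β) (N : ℕ) : Multigraph G.vertexSet where
  mult x y := if x = y then 0 else (min {e | G.IsLink e x y}.encard N).toNat
  mult_comm x y := by simp only [eq_comm (a := x), G.isLink_comm (x := (x : α))]
  mult_self x := if_pos rfl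

theorem mult_ofGraph_le (x y : G.vertexSet) :
    ((ofGraph G N).mult x y : ℕ∞) ≤ {e | G.IsLink e x y}.encard := by
  unfold ofGraph
  dsimp only
  split_ifs
  · exact zero_le
  · exact (ENat.natCast_toNat_le_self _).trans (min_le_left _ _)

theorem adj_of_adj_ofGraph {x y : G.vertexSet} (h : (ofGraph G N).simple.Adj x y) :
    G.Adj x y := by
  have hpos : 0 < {e | G.IsLink e x y}.encard :=
    (Nat.cast_pos.2 h).trans_le (mult_ofGraph_le x y)
  exact Set.encard_pos.1 hpos

theorem adj_ofGraph (hN : 0 < N) {x y : G.vertexSet} (hne : x ≠ y) (h : G.Adj x y) :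
    (ofGraph G N).simple.Adj x y := by
  have hpos : min {e | G.IsLink e x y}.encard N ≠ 0 := by
    have hlink : 0 < {e | G.IsLink e x y}.encard := Set.encard_pos.2 h
    exact (lt_min hlink (Nat.cast_pos.2 hN)).ne'
  have htop : min {e | G.IsLink e x y}.encard N ≠ ⊤ :=
    ((min_le_right _ _).trans_lt (ENat.natCast_lt_top N)).ne
  have hmult : (ofGraph G N).mult x y = (min {e | G.IsLink e x y}.encard N).toNat := if_neg hne
  exact (Nat.pos_of_ne_zero fun h0 =>
    (ENat.toNat_eq_zero.1 h0).elim hpos htop).trans_eq hmult.symm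

section Treewidth

theorem treewidth_le_width {ι : Type} [Fintype ι] (D : G.TreeDecomposition ι) :
    G.treewidth ≤ D.width := by
  refine csInf_le ⟨-1, ?_⟩ ⟨ι, inferInstance, D, rfl⟩
  rintro w ⟨ι', _, D', rfl⟩
  rw [Graph.TreeDecomposition.width]
  lia

variable [DecidableEq G.vertexSet] {bag : ℕ → Finset G.vertexSet} {par : ℕ → ℕ}

/-- The tree-decomposition given by a bag sequence that covers all vertices. -/
def IsBagSequence.treeDecomposition (hN : 0 < N)
    (h : (ofGraph G N).IsBagSequence n bag par k ∅) : G.TreeDecomposition (Fin n) where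
  tree := parentGraph n par
  bag t := Subtype.val '' (bag t : Set G.vertexSet)
  isTree := parentGraph_isTree h.pos h.par_lt
  exists_bag_of_isLink e x y he := by
    suffices H : ∃ i < n, ⟨x, he.left_mem⟩ ∈ bag i ∧ ⟨y, he.right_mem⟩ ∈ bag i by
      obtain ⟨i, hi, hx, hy⟩ := H
      exact ⟨⟨i, hi⟩, ⟨_, hx, rfl⟩, ⟨_, hy, rfl⟩⟩
    by_cases hxy : x = y
    · subst hxy
      simpa using h.notMem_iff ⟨x, he.left_mem⟩
    · exact h.exists_of_adj _ _ (adj_ofGraph hN (fun heq => hxy (congrArg Subtype.val heq)) ⟨e, he⟩)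
        (Finset.notMem_empty _) (Finset.notMem_empty _)
  connected u hu := by
    have hset : {t : Fin n | u ∈ Subtype.val '' (bag t : Set G.vertexSet)} =
        {t : Fin n | (⟨u, hu⟩ : G.vertexSet) ∈ bag t} := by
      ext
      simp [hu]
    exact hset ▸ h.parentGraph_induce_connected (Finset.notMem_empty (⟨u, hu⟩ : G.vertexSet))
  iUnion_bag := by
    ext x
    simp only [Set.mem_iUnion]
    refine ⟨fun ⟨_, y, _, hyx⟩ => hyx ▸ y.2, fun hx => ?_⟩
    obtain ⟨i, hi, hxi⟩ := (h.notMem_iff ⟨x, hx⟩).1 (Finset.notMem_empty _)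
    exact ⟨⟨i, hi⟩, ⟨x, hx⟩, hxi, rfl⟩

theorem IsBagSequence.treewidth_add_one_lt (hN : 0 < N)
    (h : (ofGraph G N).IsBagSequence n bag par k ∅) : G.treewidth + 1 < k := by
  have hbag : ∀ i : Fin n, ((h.treeDecomposition hN).bag i).ncard < k := fun i =>
    (Set.ncard_image_le (Finset.finite_toSet _)).trans_lt
      ((Set.ncard_coe_finset _).trans_lt (h.card_lt i i.2))
  have hsup := (Finset.sup_lt_iff (s := Finset.univ)
    (Nat.zero_lt_of_lt (h.card_lt 0 h.pos))).2 fun i _ => hbag i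
  have hwidth := treewidth_le_width (h.treeDecomposition hN)
  rw [Graph.TreeDecomposition.width] at hwidth
  lia

theorem exists_tangled_of_le_treewidth [Fintype G.vertexSet] (hN : 0 < N) (hm : 0 < m)
    (ht : 0 < t) (htw : 3 * m ≤ G.treewidth + 1) : ∃ p, (ofGraph G N).Tangled p t m := by
  by_contra! hcon
  obtain ⟨n, bag, par, hseq⟩ := exists_isBagSequence (G := ofGraph G N) hm fun W _ => by
    by_contra! hW
    exact hcon _ (tangled_of_forall_not_isBalancedSeparator ht hW)
  have hlt := hseq.treewidth_add_one_lt hN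
  push_cast at hlt
  lia

end Treewidth

section Minor

variable {P Q : Finset G.vertexSet}

theorem Conn.isConnected_induce (hP : (ofGraph G N).Conn P) :
    (G.induce (Subtype.val '' (P : Set G.vertexSet))).IsConnected := by
  obtain ⟨x, hx⟩ := hP.nonempty
  refine ⟨⟨x, x, hx, rfl⟩, ?_⟩
  rintro _ ⟨y, hy, rfl⟩ _ ⟨z, hz, rfl⟩
  have hyz := (SimpleGraph.reachable_iff_reflTransGen _ _).1 (hP.preconnected ⟨y, hy⟩ ⟨z, hz⟩)
  refine hyz.lift (fun a : (P : Set G.vertexSet) => ((a : G.vertexSet) : α)) (fun a b hab => ?_)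
    _ _
  obtain ⟨e, he⟩ := adj_of_adj_ofGraph hab
  exact ⟨e, he, ⟨a, a.2, rfl⟩, ⟨b, b.2, rfl⟩⟩

theorem edges_ofGraph_le (hPQ : Disjoint P Q) :
    ((ofGraph G N).edges P Q : ℕ∞) ≤ {e | ∃ x ∈ P, ∃ y ∈ Q, G.IsLink e x y}.encard := by
  let E : G.vertexSet × G.vertexSet → Set β := fun q => {e | G.IsLink e q.1 q.2}
  have hdisj : ((P ×ˢ Q : Finset _) : Set (G.vertexSet × G.vertexSet)).PairwiseDisjoint E := by
    rintro ⟨x, y⟩ hxy ⟨x', y'⟩ hxy' hne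
    obtain ⟨hx, -⟩ := Finset.mem_product.1 hxy
    obtain ⟨-, hy'⟩ := Finset.mem_product.1 hxy'
    refine Set.disjoint_left.2 fun e he he' => ?_
    obtain ⟨h1, h2⟩ | ⟨h1, -⟩ := Graph.IsLink.eq_and_eq_or_eq_and_eq he he'
    · exact hne (Prod.ext (Subtype.ext h1) (Subtype.ext h2))
    · exact Finset.disjoint_left.1 hPQ hx (Subtype.ext h1 ▸ hy')
  calc ((ofGraph G N).edges P Q : ℕ∞)
      = ∑ q ∈ P ×ˢ Q, ((ofGraph G N).mult q.1 q.2 : ℕ∞) := by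
        rw [edges, Finset.sum_product]
        push_cast
        rfl
    _ ≤ ∑ q ∈ P ×ˢ Q, (E q).encard := Finset.sum_le_sum fun q _ => mult_ofGraph_le q.1 q.2
    _ = (⋃ q ∈ ((P ×ˢ Q : Finset _) : Set (G.vertexSet × G.vertexSet)), E q).encard := by
        rw [(Finset.finite_toSet _).encard_biUnion hdisj, finsum_mem_coe_finset]
    _ ≤ {e | ∃ x ∈ P, ∃ y ∈ Q, G.IsLink e x y}.encard :=
        Set.encard_le_encard <| Set.iUnion₂_subset fun q hq e he =>
          ⟨q.1, (Finset.mem_product.1 hq).1, q.2, (Finset.mem_product.1 hq).2, he⟩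

theorem exists_injective_fin_of_le_encard {s : Set β} (h : (r : ℕ∞) ≤ s.encard) :
    ∃ f : Fin r → β, Function.Injective f ∧ ∀ l, f l ∈ s := by
  obtain ⟨T, hTs, hT⟩ := Set.exists_subset_encard_eq h
  have hTfin : T.Finite := Set.finite_of_encard_eq_coe hT
  have := hTfin.fintype
  have hcard : Nat.card T = r := by
    rw [Nat.card_coe_set_eq, Set.ncard, hT, ENat.toNat_natCast]
  let e : T ≃ Fin r := Finite.equivFinOfCardEq hcard
  exact ⟨fun l => e.symm l, Subtype.val_injective.comp e.symm.injective, fun l => hTs (e.symm l).2⟩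

theorem isMinor_of_branchSets {γ δ : Type*} {H : Graph γ δ} {B : γ → Set α} {edge : H.edgeSet → β}
    (hH : H.Loopless) (hconn : ∀ v ∈ H.vertexSet, (G.induce (B v)).IsConnected)
    (hsub : ∀ v ∈ H.vertexSet, B v ⊆ G.vertexSet)
    (hdisj : ∀ v ∈ H.vertexSet, ∀ w ∈ H.vertexSet, v ≠ w → Disjoint (B v) (B w))
    (hinj : Function.Injective edge)
    (hlink : ∀ (e : H.edgeSet) (v w : γ), H.IsLink e v w →
      ∃ x ∈ B v, ∃ y ∈ B w, G.IsLink (edge e) x y) : H.IsMinor G := by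
  refine ⟨fun v => G.induce (B v), edge, fun v hv => ⟨G.induce_le (hsub v hv), hconn v hv⟩, hdisj,
    hinj, fun e u hu ⟨a, b, hab, ha, hb⟩ => ?_, hlink⟩
  obtain ⟨v, w, hvw⟩ := H.exists_isLink_of_mem_edgeSet e.2
  obtain ⟨x, hx, y, hy, hxy⟩ := hlink e v w hvw
  have hxu : x ∈ B u := by
    obtain ⟨rfl, -⟩ | ⟨rfl, -⟩ := hxy.eq_and_eq_or_eq_and_eq hab <;> assumption
  have hyu : y ∈ B u := by
    obtain ⟨-, rfl⟩ | ⟨-, rfl⟩ := hxy.eq_and_eq_or_eq_and_eq hab <;> assumption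
  have heq : ∀ z ∈ H.vertexSet, ∀ c ∈ B z, c ∈ B u → z = u := fun z hz c hcz hcu =>
    by_contra fun hne => Set.disjoint_left.1 (hdisj z hz u hu hne) hcz hcu
  exact hvw.ne ((heq v hvw.left_mem x hx hxu).trans (heq w hvw.right_mem y hy hyu).symm)

theorem loopless_copies_theta (k r : ℕ) : (Graph.copies k (Graph.theta r)).Loopless where
  not_isLoopAt e x h := by simp [← Graph.isLink_self_iff, Graph.copies, Graph.theta] at h

theorem isMinor_copies_theta_of_branchSets {B : Fin k × Bool → Set α} {f : Fin k → Fin r → β}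
    (hconn : ∀ v, (G.induce (B v)).IsConnected) (hsub : ∀ v, B v ⊆ G.vertexSet)
    (hdisj : ∀ v w, v ≠ w → Disjoint (B v) (B w)) (hf : ∀ i, Function.Injective (f i))
    (hlink : ∀ i l, ∃ x ∈ B (i, false), ∃ y ∈ B (i, true), G.IsLink (f i l) x y) :
    (Graph.copies k (Graph.theta r)).IsMinor G := by
  have heq : ∀ {v w x}, x ∈ B v → x ∈ B w → v = w := fun {v w x} hv hw =>
    by_contra fun hne => Set.disjoint_left.1 (hdisj v w hne) hv hw
  refine isMinor_of_branchSets (B := B) (edge := fun e => f e.1.1 e.1.2)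
    (loopless_copies_theta k r) (fun v _ => hconn v) (fun v _ => hsub v)
    (fun v _ w _ => hdisj v w) ?_ ?_
  · rintro ⟨⟨i, l⟩, hl⟩ ⟨⟨j, l'⟩, hl'⟩ hll'
    change f i l = f j l' at hll'
    obtain ⟨x, hx, y, -, hxy⟩ := hlink i l
    obtain ⟨x', hx', y', hy', hxy'⟩ := hlink j l'
    obtain ⟨rfl, -⟩ | ⟨rfl, -⟩ := hxy.eq_and_eq_or_eq_and_eq (hll' ▸ hxy')
    · obtain rfl : i = j := congrArg Prod.fst (heq hx hx')
      simp [hf i hll']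
    · exact absurd (congrArg Prod.snd (heq hx hy')) Bool.false_ne_true
  · rintro ⟨⟨i, l⟩, hl⟩ ⟨a, v⟩ ⟨b, w⟩ ⟨hai, hbi, hvw⟩
    obtain rfl : a = i := hai
    obtain rfl : b = a := hbi
    obtain ⟨x, hx, y, hy, hxy⟩ := hlink b l
    obtain ⟨rfl, rfl⟩ | ⟨rfl, rfl⟩ := ((Graph.banana_isLink ..).mp hvw).2
    · exact ⟨x, hx, y, hy, hxy⟩
    · exact ⟨y, hy, x, hx, hxy.symm⟩

theorem Packing.isMinor [DecidableEq G.vertexSet] (h : (ofGraph G N).Packing k r) :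
    (Graph.copies k (Graph.theta r)).IsMinor G := by
  obtain ⟨P, Q, hmodel, hdisj⟩ := h
  choose f hf hlink using fun i => exists_injective_fin_of_le_encard
    ((Nat.cast_le.2 (hmodel i).le_edges).trans (edges_ofGraph_le (hmodel i).disjoint))
  let C : Fin k × Bool → Finset G.vertexSet := fun v => if v.2 then Q v.1 else P v.1
  have hCsub : ∀ i b, C (i, b) ⊆ P i ∪ Q i := by
    rintro i (_ | _)
    exacts [Finset.subset_union_left, Finset.subset_union_right]
  have hC : ∀ v w, v ≠ w → Disjoint (C v) (C w) := by
    rintro ⟨i, b⟩ ⟨j, b'⟩ hne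
    obtain rfl | hij := eq_or_ne i j
    · cases b <;> cases b'
      exacts [absurd rfl hne, (hmodel i).disjoint, (hmodel i).disjoint.symm, absurd rfl hne]
    · exact (hdisj hij).mono (hCsub i b) (hCsub j b')
  refine isMinor_copies_theta_of_branchSets (B := fun v => Subtype.val '' (C v : Set G.vertexSet))
    ?_ (fun v => Subtype.coe_image_subset _ _) (fun v w hvw => ?_) hf fun i l => ?_
  · rintro ⟨i, _ | _⟩
    exacts [(hmodel i).conn_left.isConnected_induce, (hmodel i).conn_right.isConnected_induce]
  · exact (Set.disjoint_image_iff Subtype.val_injective).2 (Finset.disjoint_coe.2 (hC v w hvw))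
  · obtain ⟨x, hx, y, hy, hxy⟩ := hlink i l
    exact ⟨x, ⟨x, hx, rfl⟩, y, ⟨y, hy, rfl⟩, hxy⟩

end Minor

end OfGraph

section Bounds

variable {q k e : ℕ}

theorem highDeg_pos (hq : 0 < q) : 0 < highDeg q :=
  Nat.mul_pos hq (Nat.mul_pos hq (Nat.succ_pos _))

theorem three_mul_highDeg_le_pow (hq : 0 < q) :
    3 * (2 * highDeg q * (4 + 8 * ((q + 1) * (q + 4)) + (q + 1)) + 2 * (2 * highDeg q) + 1) ≤
      64 ^ (q + 1) := by
  unfold highDeg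
  induction q, hq using Nat.le_induction with
  | base => norm_num
  | succ q hq ih =>
    have hsq : q ≤ q ^ 2 := Nat.le_self_pow two_ne_zero q
    rw [pow_succ 64 (q + 1)]
    refine le_trans ?_ (Nat.mul_le_mul_right 64 ih)
    ring_nf
    lia

theorem three_mul_order_le (hq : 0 < q) (hk : 0 < k) (he : 0 < e) :
    3 * (k * (2 * highDeg q * (2 * (2 + 4 * (q + 3 + e) * (q + 1)) + (q + 1))) +
      2 * (2 * highDeg q) + 1) ≤ 64 ^ (q + 1) * (k * e) := by
  set t := 2 * highDeg q
  set c := 4 + 8 * ((q + 1) * (q + 4)) + (q + 1) with hc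
  have hlinear : 2 * (2 + 4 * (q + 3 + e) * (q + 1)) + (q + 1) ≤ c * e := by
    obtain ⟨e, rfl⟩ := Nat.exists_eq_add_one.2 he
    rw [hc]
    nlinarith [Nat.zero_le (q * e), Nat.zero_le (q * q * e)]
  calc 3 * (k * (t * (2 * (2 + 4 * (q + 3 + e) * (q + 1)) + (q + 1))) + 2 * t + 1)
      ≤ 3 * (k * (t * (c * e)) + (2 * t + 1) * (k * e)) := by
        have hconst := Nat.le_mul_of_pos_right (2 * t + 1) (Nat.mul_pos hk he)
        rw [add_assoc]
        gcongr
    _ = 3 * (t * c + 2 * t + 1) * (k * e) := by ring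
    _ ≤ 64 ^ (q + 1) * (k * e) := Nat.mul_le_mul_right _ (three_mul_highDeg_le_pow hq)

theorem add_three_le_two_pow (hq : 0 < q) : q + 3 ≤ 2 ^ (q + 1) := by
  induction q, hq using Nat.le_induction with
  | base => norm_num
  | succ q _ ih => rw [pow_succ]; lia

end Bounds

section Treewidth

variable {α β : Type*} {G : Graph α β} {k q r : ℕ}

theorem packing_of_natLog_le_treewidth [Finite G.vertexSet] [DecidableEq G.vertexSet]
    (hq : 0 < q) (hk : 0 < k)
    (h : (64 ^ (q + 1) * (k * Nat.log 2 (k + 1)) : ℕ) ≤ G.treewidth) :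
    (ofGraph G (q + 1)).Packing k (q + 1) := by
  have := Fintype.ofFinite G.vertexSet
  set e := Nat.log 2 (k + 1)
  have he : 0 < e := Nat.log_pos one_lt_two (Nat.succ_lt_succ hk)
  have hke : k ≤ 2 ^ (e + 1) :=
    (Nat.le_succ k).trans (Nat.lt_pow_succ_log_self one_lt_two _).le
  have hρ : 2 * (k * (q + 3)) ≤ 2 ^ (q + 3 + e) :=
    calc 2 * (k * (q + 3)) ≤ 2 * (2 ^ (e + 1) * 2 ^ (q + 1)) := by
          gcongr
          exact add_three_le_two_pow hq
      _ = 2 ^ (q + 3 + e) := by ring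
  obtain ⟨p, hp⟩ := exists_tangled_of_le_treewidth (N := q + 1) q.succ_pos (Nat.succ_pos _)
    (Nat.mul_pos two_pos (highDeg_pos hq))
    (((Nat.cast_le.2 (three_mul_order_le hq hk he)).trans h).trans (Int.le_add_one le_rfl))
  exact hp.packing hq hρ k le_rfl _ _ (Nat.lt_succ_self _)

theorem packing_of_logb_le_treewidth [Finite G.vertexSet] [DecidableEq G.vertexSet] (hr : 2 ≤ r)
    (h : (2 : ℝ) ^ (6 * r) * k * Real.logb 2 (k + 1) ≤ G.treewidth) :
    (ofGraph G r).Packing k r := by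
  obtain rfl | hk := k.eq_zero_or_pos
  · exact packing_zero r
  obtain ⟨q, rfl⟩ := Nat.exists_eq_add_of_le' (one_le_two.trans hr)
  refine packing_of_natLog_le_treewidth (Nat.succ_le_succ_iff.1 hr) hk ?_
  have hreal : ((64 ^ (q + 1) * (k * Nat.log 2 (k + 1)) : ℕ) : ℝ) ≤ G.treewidth :=
    calc ((64 ^ (q + 1) * (k * Nat.log 2 (k + 1)) : ℕ) : ℝ)
        = (2 : ℝ) ^ (6 * (q + 1)) * k * Nat.log 2 (k + 1) := by
          rw [pow_mul]
          push_cast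
          norm_num [mul_assoc]
      _ ≤ (2 : ℝ) ^ (6 * (q + 1)) * k * Real.logb 2 (k + 1) := by
          gcongr
          exact_mod_cast Real.natLog_le_logb (k + 1) 2
      _ ≤ G.treewidth := h
  exact_mod_cast hreal

theorem isBigO_mul_logb_add_one (C : ℝ) :
    (fun k : ℕ => C * k * Real.logb 2 (k + 1)) =O[Filter.atTop]
      fun k : ℕ => (k : ℝ) * Real.logb 2 k := by
  refine Asymptotics.IsBigO.of_bound (|C| * 2) ?_
  filter_upwards [Filter.eventually_ge_atTop 2] with k hk
  have hk' : (2 : ℝ) ≤ k := by exact_mod_cast hk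
  have hlog : 0 ≤ Real.logb 2 (k + 1) := Real.logb_nonneg one_lt_two (by linarith)
  have hle : Real.logb 2 ((k : ℝ) + 1) ≤ 2 * Real.logb 2 k :=
    calc Real.logb 2 ((k : ℝ) + 1) ≤ Real.logb 2 ((k : ℝ) ^ 2) :=
          Real.logb_le_logb_of_le one_lt_two (by linarith) (by nlinarith)
      _ = 2 * Real.logb 2 k := Real.logb_pow 2 k 2
  rw [Real.norm_eq_abs, Real.norm_eq_abs, abs_mul, abs_mul, abs_mul, abs_of_nonneg hlog,
    mul_assoc, mul_assoc, mul_left_comm 2]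
  gcongr
  exact hle.trans (by gcongr; exact le_abs_self _)

end Treewidth

end Multigraph

theorem theorem5_general :
    (∀ (α : Type*) (β : Type*) (G : Graph α β), G.vertexSet.Finite →
      ∀ r k : ℕ, 2 ≤ r →
        (2 : ℝ) ^ (6 * r) * k * Real.logb 2 (k + 1) ≤ (G.treewidth : ℝ) →
        (Graph.copies k (Graph.theta r)).IsMinor G) ∧
    (∀ r : ℕ, ∃ c : ℕ → ℝ,
      (c =O[Filter.atTop] fun k : ℕ => (k : ℝ) * Real.logb 2 k) ∧
      ∀ (k : ℕ) (α : Type*) (β : Type*) (G : Graph α β), G.vertexSet.Finite →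
        ¬ (Graph.copies k (Graph.theta r)).IsMinor G →
        (G.treewidth : ℝ) ≤ c k) := by
  classical
  refine ⟨fun α β G hV r k hr h => ?_, fun r =>
    ⟨_, Multigraph.isBigO_mul_logb_add_one (2 ^ (6 * max r 2)), fun k α β G hV hG => ?_⟩⟩
  · have := hV.to_subtype
    exact (Multigraph.packing_of_logb_le_treewidth hr h).isMinor
  · have := hV.to_subtype
    by_contra! hlt
    exact hG ((Multigraph.packing_of_logb_le_treewidth (le_max_right r 2) hlt.le).mono le_rfl
      (le_max_left r 2)).isMinor

theorem theorem5 :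
    (∀ (α : Type*) (β : Type*) (G : Graph α β),
      G.vertexSet.Finite → G.edgeSet.Finite → G.Loopless →
      ∀ r k : ℕ, 2 ≤ r → 1 ≤ k →
        (2 : ℝ) ^ (6 * r) * k * Real.logb 2 (k + 1) ≤ (G.treewidth : ℝ) →
        (Graph.copies k (Graph.theta r)).IsMinor G) ∧
    (∀ r : ℕ, ∃ c : ℕ → ℝ,
      (c =O[Filter.atTop] fun k : ℕ => (k : ℝ) * Real.logb 2 k) ∧
      ∀ (k : ℕ) (α : Type*) (β : Type*) (G : Graph α β),
        G.vertexSet.Finite → G.edgeSet.Finite → G.Loopless →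
        ¬ (Graph.copies k (Graph.theta r)).IsMinor G →
        (G.treewidth : ℝ) ≤ c k) :=
  theorem5_general.imp (fun h α β G hV _ _ r k hr _ => h α β G hV r k hr) fun h r =>
    (h r).imp fun _ hc => ⟨hc.1, fun k α β G hV _ _ => hc.2 k α β G hV⟩
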